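/- Let $p$ be a prime, $S$ a finite $p$-group and $\mathcal F$ a saturated fusion system on $S$. Write $\mathcal F(Q,P)$ for the set of $\mathcal F$-morphisms $Q\to P$, and $[Q]_{\mathcal F}$ for the set of subgroups of $S$ that are $\mathcal F$-conjugate (isomorphic in $\mathcal F$) to $Q$. Let $A(S)$ be the Burnside ring of $S$, i.e. the Grothendieck ring of finite $S$-sets, and $A(\mathcal F)\subseteq A(S)$ the subring of $\mathcal F$-stable elements, i.e. those $X$ whose restriction along every morphism $\varphi\colon P\to S$ in $\mathcal F$ equals, in $A(P)$, the restriction of $X$ along the inclusion $P\le S$. Let $A(\mathcal F)_{(p)}\subseteq A(S)_{(p)}$ be the $p$-localizations, and for $Q\le S$ let $\Phi_Q\colon A(S)_{(p)}\to\mathbb Z_{(p)}$ be the homomorphism that counts $Q$-fixed points. There is a $\mathbb Z_{(p)}$-linear map $\pi\colon A(S)_{(p)}\to A(\mathcal F)_{(p)}$ such that for every $X$, $\pi(X)$ is the unique element of $A(S)_{(p)}$ with \[\Phi_Q(\pi(X))=\frac1{|[Q]_{\mathcal F}|}\sum_{Q'\in[Q]_{\mathcal F}}\Phi_{Q'}(X)\qquad\text{for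 all }Q\le S.\] Put $\beta_P:=\pi([S/P])$ for $P\le S$. Then: 1. $\beta_P$ depends only on the $\mathcal F$-conjugacy class of $P$, and the elements $\beta_P$, with $P$ running over the subgroups of $S$ up to $\mathcal F$-conjugacy, form a $\mathbb Z_{(p)}$-basis of $A(\mathcal F)_{(p)}$. 2. For all $P,Q\le S$, \[\Phi_Q(\beta_P)=\frac{|\mathcal F(Q,P)|\cdot|S|}{|P|\cdot|\mathcal F(Q,S)|}.\] 3. For each $P\le S$, the element $\beta_P$ is the following $\mathbb Z_{(p)}$-linear combination of transitive $S$-sets, where $[R]_S$ runs over the $S$-conjugacy classes of subgroups of $S$ and $\mu$ is the Möbius function of the poset of subgroups of $S$: \[\beta_P=\sum_{[R]_S}\frac1{\Phi_R([S/R])}\Bigl(\sum_{R\le Q\le S}\Phi_Q(\beta_P)\,\mu(R,Q)\Bigr)[S/R] =\sum_{[R]_S}\frac{|R|\cdot|S|}{|N_S R|\cdot|P|}\Bigl(\sum_{R\le Q\le S}\frac{|\mathcal F(Q,P)|}{|\mathcal F(Q,S)|}\,\mu(R,Q)\Bigr)[S/R].\] In particular, the coefficients lie in $\mathbb Z_{(p)}$,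 and the coefficient of $[S/R]$ is $0$ unless $R$ is $\mathcal F$-conjugate to a subgroup of $P$. -/

import Mathlib

open scoped TensorProduct

universe u

/-! ### The Grothendieck ring of a commutative semiring -/

/-- The additive Grothendieck group of a commutative semiring. -/
def GrothendieckRing (M : Type*) [CommSemiring M] : Type _ :=
  Algebra.GrothendieckAddGroup M

namespace GrothendieckRing

open Algebra

variable {M : Type*} [CommSemiring M]

noncomputable instance : AddCommGroup (GrothendieckRing M) :=
  inferInstanceAs (AddCommGroup (GrothendieckAddGroup M))

/-- The canonical additive map from `M`. -/
noncomputable def of : M →+ GrothendieckRing M := GrothendieckAddGroup.of (M := M)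

/-- The universal property: additive extension to abelian groups. -/
noncomputable def liftAdd {G : Type*} [AddCommGroup G] (f : M →+ G) : GrothendieckRing M →+ G :=
  GrothendieckAddGroup.lift f

theorem liftAdd_of {G : Type*} [AddCommGroup G] (f : M →+ G) (m : M) :
    liftAdd f (of m) = f m :=
  DFunLike.congr_fun (GrothendieckAddGroup.lift.symm_apply_apply f) m

theorem exists_sub (x : GrothendieckRing M) : ∃ a b : M, x = of a - of b := by
  change GrothendieckAddGroup M at x
  change ∃ a b : M, x = GrothendieckAddGroup.of a - GrothendieckAddGroup.of b
  induction x using AddLocalization.ind with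
  | _ y =>
    obtain ⟨a, b⟩ := y
    refine ⟨a, b, ?_⟩
    rw [eq_sub_iff_add_eq]
    simp only [GrothendieckAddGroup.of, AddSubmonoid.LocalizationMap.toAddMonoidHom_apply,
      ← AddLocalization.mk_zero_eq_addMonoidOf_mk, AddLocalization.mk_add]
    rw [AddLocalization.mk_eq_mk_iff, AddLocalization.r_iff_exists]
    exact ⟨0, by simp [add_comm]⟩

theorem addHom_ext {G : Type*} [AddCommGroup G] {f g : GrothendieckRing M →+ G}
    (h : ∀ m, f (of m) = g (of m)) : f = g := by
  ext x
  obtain ⟨a, b, rfl⟩ := exists_sub x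
  rw [map_sub, map_sub, h, h]

/-- Multiplication, extended biadditively from the semiring `M`. -/
noncomputable def mulHom : GrothendieckRing M →+ GrothendieckRing M →+ GrothendieckRing M :=
  liftAdd
    { toFun := fun m => liftAdd (of.comp (AddMonoidHom.mulLeft m))
      map_zero' := addHom_ext fun x => by simp [liftAdd_of]
      map_add' := fun a b => addHom_ext fun x => by simp [liftAdd_of, add_mul] }

theorem mulHom_of (a b : M) : mulHom (of a) (of b) = of (a * b) := by
  rw [mulHom, liftAdd_of]
  exact liftAdd_of _ b

noncomputable instance : Mul (GrothendieckRing M) := ⟨fun x y => mulHom x y⟩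

noncomputable instance : One (GrothendieckRing M) := ⟨of 1⟩

theorem mul_def (x y : GrothendieckRing M) : x * y = mulHom x y := rfl

theorem one_def : (1 : GrothendieckRing M) = of 1 := rfl

protected theorem mul_comm' (x y : GrothendieckRing M) : x * y = y * x := by
  obtain ⟨a, b, rfl⟩ := exists_sub x
  obtain ⟨c, d, rfl⟩ := exists_sub y
  simp only [mul_def, map_sub, AddMonoidHom.sub_apply, mulHom_of, mul_comm c, mul_comm d]
  abel

protected theorem mul_assoc' (x y z : GrothendieckRing M) : x * y * z = x * (y * z) := by
  obtain ⟨a, b, rfl⟩ := exists_sub x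
  obtain ⟨c, d, rfl⟩ := exists_sub y
  obtain ⟨e, f, rfl⟩ := exists_sub z
  simp only [mul_def, map_sub, AddMonoidHom.sub_apply, mulHom_of, mul_assoc]

protected theorem one_mul' (x : GrothendieckRing M) : 1 * x = x := by
  obtain ⟨a, b, rfl⟩ := exists_sub x
  simp only [mul_def, one_def, map_sub, mulHom_of, one_mul]

noncomputable instance : CommRing (GrothendieckRing M) :=
  { (inferInstance : AddCommGroup (GrothendieckRing M)) with
    mul := (· * ·)
    one := 1
    mul_comm := GrothendieckRing.mul_comm'
    mul_assoc := GrothendieckRing.mul_assoc'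
    one_mul := GrothendieckRing.one_mul'
    mul_one := fun x => by rw [GrothendieckRing.mul_comm', GrothendieckRing.one_mul']
    zero_mul := fun x => by simp [mul_def]
    mul_zero := fun x => by simp [mul_def]
    left_distrib := fun x y z => by simp [mul_def]
    right_distrib := fun x y z => by simp [mul_def] }

/-- A semiring homomorphism to a commutative ring extends to the Grothendieck ring. -/
noncomputable def lift {R : Type*} [CommRing R] (f : M →+* R) : GrothendieckRing M →+* R :=
  { liftAdd (f : M →+ R) with
    map_one' := by
      change liftAdd (f : M →+ R) (of 1) = 1
      rw [liftAdd_of]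
      exact map_one f
    map_mul' := fun x y => by
      change liftAdd (f : M →+ R) (x * y) = liftAdd (f : M →+ R) x * liftAdd (f : M →+ R) y
      obtain ⟨a, b, rfl⟩ := exists_sub x
      obtain ⟨c, d, rfl⟩ := exists_sub y
      simp only [mul_def, map_sub, AddMonoidHom.sub_apply, mulHom_of, liftAdd_of,
        AddMonoidHom.coe_coe, map_mul]
      ring }

/-- The canonical map from `M`, as a semiring homomorphism. -/
noncomputable def ofHom : M →+* GrothendieckRing M :=
  { (of : M →+ GrothendieckRing M) with
    map_one' := rfl
    map_mul' := fun a b => (mulHom_of a b).symm }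

end GrothendieckRing

/-! ### The Burnside ring of a group -/

/-- A finite left `G`-set. -/
structure FinGSet (G : Type u) [Group G] where
  carrier : Type u
  [finite : Finite carrier]
  [action : MulAction G carrier]

namespace FinGSet

attribute [instance] FinGSet.finite FinGSet.action

variable {G : Type u} [Group G]

/-- Isomorphism of `G`-sets. -/
def Iso (X Y : FinGSet G) : Prop :=
  ∃ e : X.carrier ≃ Y.carrier, ∀ (g : G) (x : X.carrier), e (g • x) = g • e x

instance isoSetoid (G : Type u) [Group G] : Setoid (FinGSet G) where
  r := Iso
  iseqv :=
    { refl := fun _ => ⟨Equiv.refl _, fun _ _ => rfl⟩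
      symm := fun ⟨e, he⟩ => ⟨e.symm, fun g y => by
        rw [Equiv.symm_apply_eq, he, Equiv.apply_symm_apply]⟩
      trans := fun ⟨e, he⟩ ⟨f, hf⟩ => ⟨e.trans f, fun g x => by simp [he, hf]⟩ }

/-- Disjoint union. -/
def sum (X Y : FinGSet G) : FinGSet G := ⟨X.carrier ⊕ Y.carrier⟩

/-- Cartesian product with the diagonal action. -/
def prod (X Y : FinGSet G) : FinGSet G := ⟨X.carrier × Y.carrier⟩

/-- The empty `G`-set. -/
def empty (G : Type u) [Group G] : FinGSet G :=
  { carrier := PEmpty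
    action :=
      { smul := fun _ x => x
        one_smul := fun _ => rfl
        mul_smul := fun _ _ _ => rfl } }

/-- The one-point `G`-set. -/
def point (G : Type u) [Group G] : FinGSet G :=
  { carrier := PUnit
    action :=
      { smul := fun _ x => x
        one_smul := fun _ => rfl
        mul_smul := fun _ _ _ => rfl } }

/-- Restriction of the action along a group homomorphism: `h` acts as `φ h`. -/
def res {H : Type u} [Group H] (φ : H →* G) (X : FinGSet G) : FinGSet H :=
  { carrier := X.carrier
    action := MulAction.compHom X.carrier φ }

/-- The transitive `G`-set `G/P`. -/
def coset [Finite G] (P : Subgroup G) : FinGSet G := ⟨G ⧸ P⟩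

/-- The number of `P`-fixed points. -/
noncomputable def fixedCard (P : Subgroup G) (X : FinGSet G) : ℕ :=
  Nat.card (MulAction.fixedPoints P X.carrier)

end FinGSet

/-- Isomorphism classes of finite `G`-sets. -/
def FinGSetClass (G : Type u) [Group G] : Type (u + 1) := Quotient (FinGSet.isoSetoid G)

namespace FinGSetClass

variable {G : Type u} [Group G]

/-- The isomorphism class of a finite `G`-set. -/
def mk (X : FinGSet G) : FinGSetClass G := Quotient.mk _ X

instance : Add (FinGSetClass G) :=
  ⟨Quotient.map₂ FinGSet.sum fun _ _ ⟨e, he⟩ _ _ ⟨f, hf⟩ =>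
    ⟨Equiv.sumCongr e f, fun g x => by
      cases x with
      | inl x => exact congrArg Sum.inl (he g x)
      | inr x => exact congrArg Sum.inr (hf g x)⟩⟩

instance : Zero (FinGSetClass G) := ⟨mk (FinGSet.empty G)⟩

instance : Mul (FinGSetClass G) :=
  ⟨Quotient.map₂ FinGSet.prod fun _ _ ⟨e, he⟩ _ _ ⟨f, hf⟩ =>
    ⟨Equiv.prodCongr e f, fun g x => Prod.ext (he g x.1) (hf g x.2)⟩⟩

instance : One (FinGSetClass G) := ⟨mk (FinGSet.point G)⟩

instance : CommSemiring (FinGSetClass G) where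
  nsmul := nsmulRec
  add_assoc := by
    rintro ⟨X⟩ ⟨Y⟩ ⟨Z⟩
    refine Quotient.sound ⟨Equiv.sumAssoc _ _ _, fun g x => ?_⟩
    rcases x with (x | x) | x <;> rfl
  zero_add := by
    rintro ⟨X⟩
    refine Quotient.sound ⟨Equiv.emptySum PEmpty X.carrier, fun g x => ?_⟩
    rcases x with x | x
    · exact x.elim
    · rfl
  add_zero := by
    rintro ⟨X⟩
    refine Quotient.sound ⟨Equiv.sumEmpty X.carrier PEmpty, fun g x => ?_⟩
    rcases x with x | x
    · rfl
    · exact x.elim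
  add_comm := by
    rintro ⟨X⟩ ⟨Y⟩
    refine Quotient.sound ⟨Equiv.sumComm _ _, fun g x => ?_⟩
    rcases x with x | x <;> rfl
  mul_assoc := by
    rintro ⟨X⟩ ⟨Y⟩ ⟨Z⟩
    exact Quotient.sound ⟨Equiv.prodAssoc _ _ _, fun g x => rfl⟩
  mul_comm := by
    rintro ⟨X⟩ ⟨Y⟩
    exact Quotient.sound ⟨Equiv.prodComm _ _, fun g x => rfl⟩
  one_mul := by
    rintro ⟨X⟩
    exact Quotient.sound ⟨Equiv.punitProd X.carrier, fun g x => rfl⟩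
  mul_one := by
    rintro ⟨X⟩
    exact Quotient.sound ⟨Equiv.prodPUnit X.carrier, fun g x => rfl⟩
  zero_mul := by
    rintro ⟨X⟩
    exact Quotient.sound ⟨Equiv.pemptyProd X.carrier, fun g x => x.1.elim⟩
  mul_zero := by
    rintro ⟨X⟩
    exact Quotient.sound ⟨Equiv.prodPEmpty X.carrier, fun g x => x.2.elim⟩
  left_distrib := by
    rintro ⟨X⟩ ⟨Y⟩ ⟨Z⟩
    refine Quotient.sound ⟨Equiv.prodSumDistrib _ _ _, fun g x => ?_⟩
    rcases x with ⟨x, y | z⟩ <;> rfl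
  right_distrib := by
    rintro ⟨X⟩ ⟨Y⟩ ⟨Z⟩
    refine Quotient.sound ⟨Equiv.sumProdDistrib _ _ _, fun g x => ?_⟩
    rcases x with ⟨x | y, z⟩ <;> rfl

/-- Restriction along a group homomorphism, on isomorphism classes. -/
def res {H : Type u} [Group H] (φ : H →* G) : FinGSetClass G →+* FinGSetClass H where
  toFun := Quotient.map (FinGSet.res φ) fun _ _ ⟨e, he⟩ => ⟨e, fun h x => he (φ h) x⟩
  map_zero' := Quotient.sound ⟨Equiv.refl _, fun _ x => x.elim⟩
  map_one' := Quotient.sound ⟨Equiv.refl _, fun _ _ => rfl⟩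
  map_add' := by
    rintro ⟨X⟩ ⟨Y⟩
    refine Quotient.sound ⟨Equiv.refl _, fun h x => ?_⟩
    rcases x with x | x <;> rfl
  map_mul' := by
    rintro ⟨X⟩ ⟨Y⟩
    exact Quotient.sound ⟨Equiv.refl _, fun h x => rfl⟩

/-- The number of `P`-fixed points, on isomorphism classes. -/
noncomputable def fixedCard (P : Subgroup G) : FinGSetClass G →+* ℤ where
  toFun := Quotient.lift (fun X => (FinGSet.fixedCard P X : ℤ)) fun X Y ⟨e, he⟩ => by
    refine congrArg Nat.cast (Nat.card_congr (e.subtypeEquiv fun x => ?_))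
    refine forall_congr' fun h => ?_
    change (h : G) • x = x ↔ (h : G) • e x = e x
    rw [← he, e.apply_eq_iff_eq]
  map_zero' := by
    change ((Nat.card (MulAction.fixedPoints P (FinGSet.empty G).carrier) : ℕ) : ℤ) = 0
    have : IsEmpty (FinGSet.empty G).carrier := inferInstanceAs (IsEmpty PEmpty)
    simp
  map_one' := by
    change ((Nat.card (MulAction.fixedPoints P (FinGSet.point G).carrier) : ℕ) : ℤ) = 1
    have : Unique (MulAction.fixedPoints P (FinGSet.point G).carrier) :=
      { default := ⟨PUnit.unit, fun _ => rfl⟩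
        uniq := fun _ => rfl }
    simp
  map_add' := by
    rintro ⟨X⟩ ⟨Y⟩
    change ((Nat.card (MulAction.fixedPoints P (X.carrier ⊕ Y.carrier)) : ℕ) : ℤ) =
      (Nat.card (MulAction.fixedPoints P X.carrier) : ℤ) +
        (Nat.card (MulAction.fixedPoints P Y.carrier) : ℤ)
    rw [← Nat.cast_add, ← Nat.card_sum]
    refine congrArg Nat.cast (Nat.card_congr ((Equiv.subtypeSum).trans
      (Equiv.sumCongr (Equiv.subtypeEquivRight fun x => ?_)
        (Equiv.subtypeEquivRight fun x => ?_))))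
    · exact forall_congr' fun h => Sum.inl_injective.eq_iff
    · exact forall_congr' fun h => Sum.inr_injective.eq_iff
  map_mul' := by
    rintro ⟨X⟩ ⟨Y⟩
    change ((Nat.card (MulAction.fixedPoints P (X.carrier × Y.carrier)) : ℕ) : ℤ) =
      (Nat.card (MulAction.fixedPoints P X.carrier) : ℤ) *
        (Nat.card (MulAction.fixedPoints P Y.carrier) : ℤ)
    rw [← Nat.cast_mul, ← Nat.card_prod]
    refine congrArg Nat.cast (Nat.card_congr ((Equiv.subtypeEquivRight fun x => ?_).trans
      (Equiv.subtypeProdEquivProd (p := fun x => x ∈ MulAction.fixedPoints P X.carrier)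
        (q := fun y => y ∈ MulAction.fixedPoints P Y.carrier))))
    exact ⟨fun hx => ⟨fun h => congrArg Prod.fst (hx h), fun h => congrArg Prod.snd (hx h)⟩,
      fun hx h => Prod.ext (hx.1 h) (hx.2 h)⟩

end FinGSetClass

/-- The Burnside ring `A(G)`: the Grothendieck ring of the semiring of isomorphism classes of
finite `G`-sets. -/
abbrev BurnsideRing (G : Type u) [Group G] : Type (u + 1) := GrothendieckRing (FinGSetClass G)

namespace BurnsideRing

variable {G : Type u} [Group G]

/-- The class `[G/P]` in `A(G)`. -/
noncomputable def coset [Finite G] (P : Subgroup G) : BurnsideRing G :=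
  GrothendieckRing.of (FinGSetClass.mk (FinGSet.coset P))

/-- The restriction homomorphism `r_φ : A(G) → A(H)` along `φ : H → G`. -/
noncomputable def res {H : Type u} [Group H] (φ : H →* G) : BurnsideRing G →+* BurnsideRing H :=
  GrothendieckRing.lift (GrothendieckRing.ofHom.comp (FinGSetClass.res φ))

/-- The fixed point homomorphism `Φ_P : A(G) → ℤ`. -/
noncomputable def mark (P : Subgroup G) : BurnsideRing G →+* ℤ :=
  GrothendieckRing.lift (FinGSetClass.fixedCard P)

end BurnsideRing

/-! ### Localization at a prime -/

/-- The ring `ℤ_(p)` of rational numbers whose denominator is prime to `p`. -/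
def ZLocal (p : ℕ) [hp : Fact p.Prime] : Subring ℚ where
  carrier := {q | ¬ p ∣ q.den}
  zero_mem' := by simpa using hp.out.one_lt.ne'
  one_mem' := by simpa using hp.out.one_lt.ne'
  add_mem' := fun {a b} ha hb h =>
    ((hp.out.dvd_mul).1 (h.trans (Rat.add_den_dvd a b))).elim ha hb
  mul_mem' := fun {a b} ha hb h =>
    ((hp.out.dvd_mul).1 (h.trans (Rat.mul_den_dvd a b))).elim ha hb
  neg_mem' := fun {a} ha => by simpa using ha

/-- The `p`-localized Burnside ring `A(G)_(p) = ℤ_(p) ⊗ A(G)`. -/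
abbrev LocalBurnsideRing (p : ℕ) [Fact p.Prime] (G : Type u) [Group G] : Type (u + 1) :=
  ZLocal p ⊗[ℤ] BurnsideRing G

namespace LocalBurnsideRing

variable (p : ℕ) [Fact p.Prime] {G : Type u} [Group G]

/-- The class `[G/P]` in `A(G)_(p)`. -/
noncomputable def coset [Finite G] (P : Subgroup G) : LocalBurnsideRing p G :=
  (1 : ZLocal p) ⊗ₜ[ℤ] BurnsideRing.coset P

/-- The fixed point homomorphism `Φ_P : A(G)_(p) → ℤ_(p)`. -/
noncomputable def mark (P : Subgroup G) : LocalBurnsideRing p G →ₐ[ZLocal p] ZLocal p :=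
  Algebra.TensorProduct.lift (AlgHom.id (ZLocal p) (ZLocal p))
    ((Int.castRingHom (ZLocal p)).comp (BurnsideRing.mark P)).toIntAlgHom
    fun _ _ => Commute.all _ _

end LocalBurnsideRing

/-! ### Fusion systems -/

/-- Conjugation `x ↦ s x s⁻¹` as a homomorphism `P → Q`, for `s P s⁻¹ ≤ Q`. -/
def conjHom {S : Type u} [Group S] (P Q : Subgroup S) (s : S)
    (h : ∀ x ∈ P, s * x * s⁻¹ ∈ Q) : P →* Q where
  toFun x := ⟨s * x * s⁻¹, h x x.2⟩
  map_one' := by ext; simp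
  map_mul' x y := by ext; simp

/-- A fusion system on `S`: `Hom P Q` is the set of morphisms from `P` to `Q`. -/
structure FusionSystem (S : Type u) [Group S] where
  Hom : ∀ P Q : Subgroup S, Set (P →* Q)
  injective : ∀ {P Q : Subgroup S} {φ : P →* Q}, φ ∈ Hom P Q → Function.Injective φ
  comp_mem : ∀ {P Q R : Subgroup S} {φ : P →* Q} {ψ : Q →* R},
    φ ∈ Hom P Q → ψ ∈ Hom Q R → ψ.comp φ ∈ Hom P R
  conj_mem : ∀ (P Q : Subgroup S) (s : S) (h : ∀ x ∈ P, s * x * s⁻¹ ∈ Q), conjHom P Q s h ∈ Hom P Q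
  /-- The corestriction of a morphism `φ` to its image `φ P` is a morphism. -/
  corestrict_mem : ∀ {P Q : Subgroup S} {φ : P →* Q}, φ ∈ Hom P Q →
    (Q.subtype.comp φ).rangeRestrict ∈ Hom P (Q.subtype.comp φ).range
  /-- The inverse `φ P → P` of the corestriction is a morphism. -/
  inverse_mem : ∀ {P Q : Subgroup S} {φ : P →* Q}, φ ∈ Hom P Q →
    ∀ ψ : (Q.subtype.comp φ).range →* P,
      (∀ x : P, ψ ((Q.subtype.comp φ).rangeRestrict x) = x) → ψ ∈ Hom (Q.subtype.comp φ).range P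

namespace FusionSystem

variable {S : Type u} [Group S] (F : FusionSystem S)

theorem id_mem (P : Subgroup S) : MonoidHom.id P ∈ F.Hom P P := by
  have h := F.conj_mem P P 1 (fun x hx => by simpa using hx)
  convert h using 1
  ext x
  simp [conjHom]

theorem symm_mem {P Q : Subgroup S} (e : P ≃* Q) (he : e.toMonoidHom ∈ F.Hom P Q) :
    e.symm.toMonoidHom ∈ F.Hom Q P := by
  have hr : ∀ x : S, x ∈ (Q.subtype.comp e.toMonoidHom).range → x ∈ Q := by
    rintro _ ⟨y, rfl⟩
    exact (e y).2
  have hQ : ∀ x ∈ Q, (1 : S) * x * 1⁻¹ ∈ (Q.subtype.comp e.toMonoidHom).range := by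
    intro x hx
    exact ⟨e.symm ⟨x, hx⟩, by simp⟩
  have h1 := F.conj_mem Q (Q.subtype.comp e.toMonoidHom).range 1 hQ
  have h2 := F.inverse_mem he (e.symm.toMonoidHom.comp (Subgroup.inclusion hr)) (by
    intro x
    exact e.symm_apply_apply x)
  convert F.comp_mem h1 h2 using 1
  ext x
  change (e.symm x : S) = e.symm ⟨1 * x * 1⁻¹, _⟩
  congr 2
  ext
  simp

/-- `F`-conjugacy of subgroups: `P ∼_F Q`. -/
def Conj (P Q : Subgroup S) : Prop := ∃ φ ∈ F.Hom P Q, Function.Bijective φ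

/-- `F`-conjugacy as an equivalence relation. -/
def conjSetoid : Setoid (Subgroup S) where
  r := F.Conj
  iseqv :=
    { refl := fun P => ⟨_, F.id_mem P, Function.bijective_id⟩
      symm := fun ⟨φ, hφ, hb⟩ =>
        ⟨(MulEquiv.ofBijective φ hb).symm.toMonoidHom, F.symm_mem (MulEquiv.ofBijective φ hb) hφ,
          (MulEquiv.ofBijective φ hb).symm.bijective⟩
      trans := fun ⟨_, hφ, hb⟩ ⟨_, hψ, hb'⟩ => ⟨_, F.comp_mem hφ hψ, hb'.comp hb⟩ }

/-- The set of `F`-conjugacy classes of subgroups. -/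
abbrev ConjClass : Type u := Quotient F.conjSetoid

/-- `Q` is `F`-subconjugate to `P`: `Q` is `F`-conjugate to a subgroup of `P`. -/
def SubConj (Q P : Subgroup S) : Prop := ∃ Q' ≤ P, F.Conj Q Q'

/-- `P` is fully `F`-normalized. -/
def FullyNormalized (P : Subgroup S) : Prop :=
  ∀ Q, F.Conj P Q → Nat.card (Subgroup.normalizer (Q : Set S)) ≤
    Nat.card (Subgroup.normalizer (P : Set S))

/-- `P` is fully `F`-centralized. -/
def FullyCentralized (P : Subgroup S) : Prop :=
  ∀ Q, F.Conj P Q → Nat.card (Subgroup.centralizer (Q : Set S)) ≤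
    Nat.card (Subgroup.centralizer (P : Set S))

/-- The automorphism group `Aut_F(P)`. -/
def aut (P : Subgroup S) : Subgroup (MulAut P) where
  carrier := {α | MulEquiv.toMonoidHom α ∈ F.Hom P P}
  one_mem' := F.id_mem P
  mul_mem' := fun ha hb => F.comp_mem hb ha
  inv_mem' := fun {a} ha => F.symm_mem a ha

/-- The subgroup `N_φ = {x ∈ N_S(P) | ∃ y ∈ S, φ ∘ c_x = c_y ∘ φ}`. -/
def extender {P : Subgroup S} (φ : P →* S) : Subgroup S where
  carrier := {x | x ∈ Subgroup.normalizer (P : Set S) ∧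
    ∃ y : S, ∀ g h : P, (h : S) = x * g * x⁻¹ → φ h = y * φ g * y⁻¹}
  one_mem' := ⟨one_mem _, 1, fun g h hh => by
    have : h = g := by ext; simpa using hh
    simp [this]⟩
  mul_mem' := by
    rintro a b ⟨ha, y, hy⟩ ⟨hb, z, hz⟩
    refine ⟨mul_mem ha hb, y * z, fun g h hh => ?_⟩
    have hbg : b * g * b⁻¹ ∈ P := (Subgroup.mem_normalizer_iff.1 hb g).1 g.2
    rw [hy ⟨_, hbg⟩ h (by rw [hh]; group), hz g ⟨_, hbg⟩ rfl]
    group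
  inv_mem' := by
    rintro a ⟨ha, y, hy⟩
    refine ⟨inv_mem ha, y⁻¹, fun g h hh => ?_⟩
    rw [hy h g (by rw [hh]; group)]
    group

/-- Saturation at the prime `p`. -/
structure IsSaturated (p : ℕ) : Prop where
  /-- Fully normalized subgroups are fully centralized, and `Aut_S(P)`, the image of `N_S(P)`, is a
  Sylow `p`-subgroup of `Aut_F(P)`. -/
  sylow : ∀ P : Subgroup S, F.FullyNormalized P → F.FullyCentralized P ∧
    ∃ T : Sylow p (F.aut P), (T : Subgroup (F.aut P)).map (F.aut P).subtype =
      P.normalizerMonoidHom.range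
  /-- A morphism `φ : P → S` with fully centralized image extends to `N_φ`. -/
  extend : ∀ (P : Subgroup S) (φ : P →* (⊤ : Subgroup S)), φ ∈ F.Hom P ⊤ →
    F.FullyCentralized ((⊤ : Subgroup S).subtype.comp φ).range →
    ∃ ψ ∈ F.Hom (extender ((⊤ : Subgroup S).subtype.comp φ)) ⊤,
      ∀ (x : P) (x' : extender ((⊤ : Subgroup S).subtype.comp φ)), (x : S) = x' → ψ x' = φ x

/-- The Burnside ring `A(F)`: the subring of `F`-stable elements of `A(S)`, those `X` with
`r_φ X = r_incl X` in `A(P)` for all morphisms `φ : P → S` of `F`. -/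
def burnsideRing : Subring (BurnsideRing S) where
  carrier := {X | ∀ (P : Subgroup S) (φ : P →* (⊤ : Subgroup S)), φ ∈ F.Hom P ⊤ →
    BurnsideRing.res ((⊤ : Subgroup S).subtype.comp φ) X = BurnsideRing.res P.subtype X}
  zero_mem' := fun _ _ _ => by simp
  one_mem' := fun _ _ _ => by simp
  add_mem' := fun ha hb P φ hφ => by simp [ha P φ hφ, hb P φ hφ]
  mul_mem' := fun ha hb P φ hφ => by simp [ha P φ hφ, hb P φ hφ]
  neg_mem' := fun ha P φ hφ => by simp [ha P φ hφ]

/-- The `p`-localization `A(F)_(p)`, as the image of `ℤ_(p) ⊗ A(F)` in `A(S)_(p)`. -/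
noncomputable def localBurnsideRing (p : ℕ) [Fact p.Prime] :
    Subalgebra (ZLocal p) (LocalBurnsideRing p S) :=
  (Algebra.TensorProduct.map (AlgHom.id (ZLocal p) (ZLocal p))
    F.burnsideRing.subtype.toIntAlgHom).range

/-- `π : A(S)_(p) → A(F)_(p)` is the stabilization map: `π X` is the unique element of `A(S)_(p)`
whose mark at `Q` is the average of the marks of `X` over the `F`-conjugacy class of `Q`. -/
def IsStabilization (p : ℕ) [Fact p.Prime]
    (π : LocalBurnsideRing p S →ₗ[ZLocal p] F.localBurnsideRing p) : Prop :=
  ∀ X Y : LocalBurnsideRing p S, (π X : LocalBurnsideRing p S) = Y ↔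
    ∀ Q : Subgroup S, (LocalBurnsideRing.mark p Q Y : ℚ) =
      1 / (Nat.card {Q' : Subgroup S // F.Conj Q Q'} : ℚ) *
        ∑ᶠ Q' : {Q' : Subgroup S // F.Conj Q Q'}, (LocalBurnsideRing.mark p Q'.1 X : ℚ)

end FusionSystem

/-! ### Subgroups of `S` -/

/-- `S`-conjugacy of subgroups as an equivalence relation. -/
def subgroupConjSetoid (S : Type u) [Group S] : Setoid (Subgroup S) where
  r P Q := ∃ s : S, P.map (MulAut.conj s).toMonoidHom = Q
  iseqv :=
    { refl := fun P => ⟨1, by ext; simp⟩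
      symm := by
        rintro P _ ⟨s, rfl⟩
        refine ⟨s⁻¹, ?_⟩
        rw [Subgroup.map_map]
        ext x
        simp [mul_assoc]
      trans := by
        rintro P _ _ ⟨s, rfl⟩ ⟨t, rfl⟩
        refine ⟨t * s, ?_⟩
        rw [Subgroup.map_map]
        congr 1
        ext x
        simp }

open Classical in
/-- The Möbius function `μ(R, Q)` of the poset of subgroups of a finite group. -/
noncomputable def subgroupMoebius {S : Type u} [Group S] [Finite S] (R Q : Subgroup S) : ℤ :=
  letI := Fintype.ofFinite (Subgroup S)
  letI : LocallyFiniteOrder (Subgroup S) := Fintype.toLocallyFiniteOrder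
  IncidenceAlgebra.mu ℤ R Q

/-!
An element of the Burnside ring is determined by its marks, and the Möbius transform at `R` of the
marks of a finite `S`-set is the number of its points with stabilizer `R`. This gives the
coefficients of an element in terms of its marks, and a congruence for the marks modulo
`|N_S(R) : R|`.

The map `π` has to be the averaging of marks over `F`-conjugacy classes; the point is that the
average of the marks of `[S/P]` is again the system of marks of a `p`-local element. Let `P` be
fully normalized, and consider the sum of `(|N_S(P)| / |N_S(R)|) [S/R]` over the `S`-classes `[R]`
in the `F`-class of `P`. Its average is a multiple of that of `[S/P]`, by a factor prime to `p`.
Its marks are already `F`-stable on the subgroups of order at least `|P|`, and they become stable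
everywhere after adding multiples of orbits `S/R` with `|R| < |P|`, one order at a time: saturation
extends an isomorphism `Q → P` onto a fully normalized `P` to `N_S(Q) → S`, and the congruence in
`N_S(Q)` shows that the marks at `P` and `Q` differ by a multiple of `|N_S(Q) : Q|`. Since averaging
fixes stable elements, the claim follows by induction on `|P|`.

The matrix of marks of the `β_P` is triangular with nonzero diagonal, so the `β_P` are linearly
independent; they span because `π` restricts to the identity on stable elements.
-/

/-! ### Finite `G`-sets and their fixed points -/

section FixedPoints

variable {G : Type u} [Group G]

theorem stabilizer_coset_mk (P : Subgroup G) (s : G) :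
    MulAction.stabilizer G (s : G ⧸ P) = P.map (MulAut.conj s).toMonoidHom := by
  have h := MulAction.stabilizer_smul_eq_stabilizer_map_conj s ((1 : G) : G ⧸ P)
  rwa [MulAction.Quotient.smul_coe, smul_eq_mul, mul_one, MulAction.stabilizer_quotient] at h

theorem card_map_conj (Q : Subgroup G) (s : G) :
    Nat.card (Q.map (MulAut.conj s).toMonoidHom) = Nat.card Q :=
  Subgroup.card_map_of_injective (MulAut.conj s).injective

theorem map_conj_le_iff_mem_normalizer [Finite G] (Q : Subgroup G) (s : G) :
    Q.map (MulAut.conj s).toMonoidHom ≤ Q ↔ s ∈ Subgroup.normalizer (Q : Set G) := by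
  rw [Subgroup.mem_normalizer_iff_map_conj_eq]
  exact ⟨fun h => Subgroup.eq_of_le_of_card_ge h (card_map_conj Q s).ge, fun h => h.le⟩

end FixedPoints

namespace FinGSet

variable {G : Type u} [Group G]

/-- The complement of the orbit of `x`, as a finite `G`-set. -/
def orbitCompl (X : FinGSet G) (x : X.carrier) : FinGSet G :=
  let orbit : SubMulAction G X.carrier :=
    { carrier := MulAction.orbit G x
      smul_mem' := fun g _ hy => MulAction.mem_orbit_of_mem_orbit g hy }
  ⟨(orbitᶜ : SubMulAction G X.carrier)⟩

theorem card_orbitCompl_lt (X : FinGSet G) (x : X.carrier) :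
    Nat.card (X.orbitCompl x).carrier < Nat.card X.carrier :=
  Finite.card_subtype_lt (x := x) fun h => h (MulAction.mem_orbit_self x)

theorem fixedCard_eq_sum_card_stabilizer [LocallyFiniteOrder (Subgroup G)]
    (Q : Subgroup G) (X : FinGSet G) :
    fixedCard Q X =
      ∑ K ∈ Finset.Ici Q, Nat.card {x : X.carrier // MulAction.stabilizer G x = K} := by
  classical
  have := Fintype.ofFinite X.carrier
  have hfixed : fixedCard Q X =
      (Finset.univ.filter fun x : X.carrier => Q ≤ MulAction.stabilizer G x).card := by
    rw [← Fintype.card_subtype, ← Nat.card_eq_fintype_card]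
    exact Nat.card_congr (Equiv.subtypeEquivRight fun x =>
      ⟨fun h g hg => h ⟨g, hg⟩, fun h g => h g.2⟩)
  rw [hfixed, Finset.card_eq_sum_card_fiberwise (f := fun x => MulAction.stabilizer G x)
    (t := Finset.Ici Q) fun x hx => by simpa using hx]
  refine Finset.sum_congr rfl fun K hK => ?_
  rw [Nat.card_eq_fintype_card, Fintype.card_subtype, Finset.filter_filter]
  congr 2
  ext x
  rw [and_iff_right_iff_imp]
  rintro rfl
  exact Finset.mem_Ici.1 hK

variable (Q P : Subgroup G)

theorem mem_fixedPoints_coset_iff (s : G) :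
    (s : G ⧸ P) ∈ MulAction.fixedPoints Q (G ⧸ P) ↔
      Q.map (MulAut.conj s⁻¹).toMonoidHom ≤ P := by
  rw [Subgroup.map_le_iff_le_comap]
  refine ⟨fun h x hx => ?_, fun h x => ?_⟩
  · have := QuotientGroup.eq.1 (h ⟨x⁻¹, inv_mem hx⟩)
    simpa [mul_assoc] using this
  · have : s⁻¹ * (x : G)⁻¹ * s⁻¹⁻¹ ∈ P := h (inv_mem x.2)
    refine QuotientGroup.eq.2 ?_
    simpa [mul_assoc, Subgroup.smul_def] using this

variable [Finite G]

theorem fixedCard_coset_mul_card :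
    fixedCard Q (coset P) * Nat.card P =
      Nat.card {s : G // Q.map (MulAut.conj s⁻¹).toMonoidHom ≤ P} := by
  have e := QuotientGroup.preimageMkEquivSubgroupProdSet P (MulAction.fixedPoints Q (G ⧸ P))
  rw [mul_comm]
  refine (Nat.card_prod _ _).symm.trans (Nat.card_congr (e.symm.trans ?_))
  exact Equiv.subtypeEquivRight (mem_fixedPoints_coset_iff Q P)

theorem exists_map_conj_le_of_fixedCard_coset_ne_zero {Q P : Subgroup G}
    (h : fixedCard Q (coset P) ≠ 0) :
    ∃ s : G, Q.map (MulAut.conj s).toMonoidHom ≤ P := by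
  have hne := mul_ne_zero h (Nat.card_pos (α := P)).ne'
  rw [fixedCard_coset_mul_card] at hne
  obtain ⟨⟨s, hs⟩⟩ := (Nat.card_ne_zero.1 hne).1
  exact ⟨s⁻¹, hs⟩

theorem fixedCard_coset_self_mul_card :
    fixedCard P (coset P) * Nat.card P = Nat.card (Subgroup.normalizer (P : Set G)) := by
  rw [fixedCard_coset_mul_card]
  refine Nat.card_congr (Equiv.subtypeEquivRight fun s => ?_)
  rw [map_conj_le_iff_mem_normalizer, inv_mem_iff]

end FinGSet

namespace FinGSetClass

variable {G : Type u} [Group G]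

theorem mk_eq_zero (X : FinGSet G) [IsEmpty X.carrier] : mk X = 0 :=
  Quotient.sound ⟨Equiv.equivOfIsEmpty _ PEmpty, fun _ x => isEmptyElim x⟩

variable [Finite G]

theorem mk_eq_coset_stabilizer (X : FinGSet G) [MulAction.IsPretransitive G X.carrier]
    (x : X.carrier) : mk X = mk (FinGSet.coset (MulAction.stabilizer G x)) := by
  have hf : Function.Bijective (MulAction.ofQuotientStabilizer G x) := by
    refine ⟨MulAction.injective_ofQuotientStabilizer G x, fun y => ?_⟩
    obtain ⟨g, rfl⟩ := MulAction.exists_smul_eq G x y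
    exact ⟨g, rfl⟩
  symm
  exact Quotient.sound ⟨Equiv.ofBijective _ hf, MulAction.ofQuotientStabilizer_smul G x⟩

theorem mk_coset_map_conj (P : Subgroup G) (s : G) :
    mk (FinGSet.coset (P.map (MulAut.conj s).toMonoidHom)) = mk (FinGSet.coset P) := by
  have : MulAction.IsPretransitive G (FinGSet.coset P).carrier :=
    inferInstanceAs (MulAction.IsPretransitive G (G ⧸ P))
  rw [mk_eq_coset_stabilizer (FinGSet.coset P) (s : G ⧸ P)]
  exact congrArg (fun Q => mk (FinGSet.coset Q)) (stabilizer_coset_mk P s).symm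

theorem mk_eq_coset_stabilizer_add (X : FinGSet G) (x : X.carrier) :
    mk X = mk (FinGSet.coset (MulAction.stabilizer G x)) + mk (X.orbitCompl x) := by
  let f : (G ⧸ MulAction.stabilizer G x) ⊕ (X.orbitCompl x).carrier → X.carrier :=
    Sum.elim (MulAction.ofQuotientStabilizer G x) Subtype.val
  have hf : Function.Bijective f := by
    constructor
    · refine (MulAction.injective_ofQuotientStabilizer G x).sumElim Subtype.val_injective ?_
      rintro a ⟨y, hy⟩ rfl
      exact hy (MulAction.ofQuotientStabilizer_mem_orbit G x a)
    · intro y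
      by_cases hy : y ∈ MulAction.orbit G x
      · obtain ⟨g, rfl⟩ := hy
        exact ⟨Sum.inl g, rfl⟩
      · exact ⟨Sum.inr ⟨y, hy⟩, rfl⟩
  symm
  refine Quotient.sound ⟨Equiv.ofBijective f hf, ?_⟩
  rintro g (a | y)
  · exact MulAction.ofQuotientStabilizer_smul G x g a
  · rfl

theorem mk_mem_closure_coset (X : FinGSet G) :
    mk X ∈ AddSubmonoid.closure (Set.range fun P : Subgroup G => mk (FinGSet.coset P)) := by
  induction h : Nat.card X.carrier using Nat.strong_induction_on generalizing X with
  | _ n ih =>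
    subst h
    rcases isEmpty_or_nonempty X.carrier with hX | ⟨⟨x⟩⟩
    · rw [mk_eq_zero]
      exact zero_mem _
    · rw [mk_eq_coset_stabilizer_add X x]
      exact add_mem (AddSubmonoid.subset_closure ⟨_, rfl⟩) (ih _ (X.card_orbitCompl_lt x) _ rfl)

end FinGSetClass

/-! ### Möbius inversion on the lattice of subgroups -/

section Moebius

variable {G : Type u} [Group G] [Finite G]

/-- The functional `f ↦ ∑_{R ≤ Q} f(Q) μ(R, Q)` on functions on the set of subgroups. -/
noncomputable def moebiusTransform (R : Subgroup G) : (Subgroup G → ℚ) →ₗ[ℚ] ℚ where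
  toFun f := ∑ᶠ Q : {Q : Subgroup G // R ≤ Q}, f Q.1 * (subgroupMoebius R Q.1 : ℚ)
  map_add' f g := by
    simp only [Pi.add_apply, add_mul]
    exact finsum_add_distrib (Set.toFinite _) (Set.toFinite _)
  map_smul' c f := by
    simp only [Pi.smul_apply, smul_eq_mul, mul_assoc, RingHom.id_apply]
    exact (mul_finsum _ _).symm

theorem moebiusTransform_apply (R : Subgroup G) (f : Subgroup G → ℚ) :
    moebiusTransform R f =
      ∑ᶠ Q : {Q : Subgroup G // R ≤ Q}, f Q.1 * (subgroupMoebius R Q.1 : ℚ) := rfl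

theorem moebiusTransform_eq_apply_of_forall_lt (R : Subgroup G) (f : Subgroup G → ℚ)
    (h : ∀ Q, R < Q → f Q = 0) : moebiusTransform R f = f R := by
  rw [moebiusTransform_apply, finsum_eq_single _ ⟨R, le_rfl⟩]
  · simp [subgroupMoebius]
  · rintro ⟨Q, hQ⟩ hne
    rw [h Q (lt_of_le_of_ne hQ fun h => hne (Subtype.ext h.symm)), zero_mul]

theorem moebiusTransform_fixedCard (R : Subgroup G) (X : FinGSet G) :
    moebiusTransform R (fun Q => (FinGSet.fixedCard Q X : ℚ)) =
      Nat.card {x : X.carrier // MulAction.stabilizer G x = R} := by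
  classical
  let := Fintype.ofFinite (Subgroup G)
  let : LocallyFiniteOrder (Subgroup G) := Fintype.toLocallyFiniteOrder
  have inversion := IncidenceAlgebra.moebius_inversion_top
    (fun Q : Subgroup G => (Nat.card {x : X.carrier // MulAction.stabilizer G x = Q} : ℤ))
    (fun Q : Subgroup G => (FinGSet.fixedCard Q X : ℤ))
    (fun Q => by rw [FinGSet.fixedCard_eq_sum_card_stabilizer, Nat.cast_sum]) R
  rw [← Int.cast_natCast (Nat.card _), inversion, moebiusTransform_apply,
    finsum_eq_sum_of_fintype, Finset.sum_subtype (p := fun Q => R ≤ Q) (Finset.Ici R) (by simp),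
    Int.cast_sum]
  refine Finset.sum_congr rfl fun Q _ => ?_
  rw [mul_comm, Int.cast_mul, Int.cast_natCast]
  congr 2

end Moebius

/-! ### Marks on the Burnside ring -/

theorem GrothendieckRing.lift_of {M R : Type*} [CommSemiring M] [CommRing R] (f : M →+* R) (m : M) :
    lift f (of m) = f m :=
  liftAdd_of (f : M →+ R) m

namespace BurnsideRing

variable {G : Type u} [Group G]

theorem mark_of_mk (Q : Subgroup G) (X : FinGSet G) :
    mark Q (GrothendieckRing.of (FinGSetClass.mk X)) = FinGSet.fixedCard Q X :=
  GrothendieckRing.lift_of _ _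

theorem res_of_mk {H : Type u} [Group H] (φ : H →* G) (X : FinGSet G) :
    res φ (GrothendieckRing.of (FinGSetClass.mk X)) =
      GrothendieckRing.of (FinGSetClass.mk (X.res φ)) :=
  GrothendieckRing.lift_of _ _

theorem addHom_ext_of_mk {A : Type*} [AddCommGroup A] {f g : BurnsideRing G →+ A}
    (h : ∀ X : FinGSet G, f (GrothendieckRing.of (FinGSetClass.mk X)) =
      g (GrothendieckRing.of (FinGSetClass.mk X))) : f = g := by
  refine GrothendieckRing.addHom_ext ?_
  rintro ⟨X⟩
  exact h X

theorem mark_res {H : Type u} [Group H] (φ : H →* G) (Q : Subgroup H) (y : BurnsideRing G) :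
    mark Q (res φ y) = mark (Q.map φ) y := by
  suffices ((mark Q).comp (res φ) : BurnsideRing G →+ ℤ) = mark (Q.map φ) from
    DFunLike.congr_fun this y
  refine addHom_ext_of_mk fun X => ?_
  change mark Q (res φ (GrothendieckRing.of _)) = mark (Q.map φ) (GrothendieckRing.of _)
  rw [res_of_mk, mark_of_mk, mark_of_mk]
  refine congrArg Nat.cast (Nat.card_congr (Equiv.subtypeEquivRight fun x => ⟨?_, ?_⟩))
  · rintro h ⟨_, g, hg, rfl⟩
    exact h ⟨g, hg⟩
  · intro h g
    exact h ⟨φ g, Subgroup.mem_map_of_mem φ g.2⟩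

theorem mark_map_conj (Q : Subgroup G) (s : G) (y : BurnsideRing G) :
    mark (Q.map (MulAut.conj s).toMonoidHom) y = mark Q y := by
  suffices (mark (Q.map (MulAut.conj s).toMonoidHom) : BurnsideRing G →+ ℤ) = mark Q from
    DFunLike.congr_fun this y
  refine addHom_ext_of_mk fun X => ?_
  change mark _ (GrothendieckRing.of _) = mark _ (GrothendieckRing.of _)
  rw [mark_of_mk, mark_of_mk]
  refine congrArg Nat.cast (Nat.card_congr ((MulAction.toPerm s).subtypeEquiv fun x => ?_).symm)
  have smul_conj (g : G) : (s * g * s⁻¹) • s • x = s • g • x := by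
    simp only [mul_smul, inv_smul_smul]
  constructor
  · rintro h ⟨_, g, hg, rfl⟩
    exact (smul_conj g).trans (congrArg (s • ·) (h ⟨g, hg⟩))
  · rintro h ⟨g, hg⟩
    exact smul_left_cancel s ((smul_conj g).symm.trans (h ⟨_, g, hg, rfl⟩))

theorem mark_out (Q : Subgroup G) (y : BurnsideRing G) :
    mark (Quotient.mk (subgroupConjSetoid G) Q).out y = mark Q y := by
  obtain ⟨s, hs⟩ := (subgroupConjSetoid G).symm (Quotient.mk_out (s := subgroupConjSetoid G) Q)
  rw [← hs, mark_map_conj]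

/-- The ghost map, which records all the marks of an element of the Burnside ring. -/
noncomputable def ghost : BurnsideRing G →+ (Subgroup G → ℚ) where
  toFun y Q := mark Q y
  map_zero' := by ext; simp
  map_add' x y := by ext; simp

theorem ghost_apply (y : BurnsideRing G) (Q : Subgroup G) : ghost y Q = mark Q y := rfl

variable [Finite G]

theorem mark_coset (Q P : Subgroup G) : mark Q (coset P) = FinGSet.fixedCard Q (FinGSet.coset P) :=
  mark_of_mk _ _

theorem mark_coset_self_mul_card (R : Subgroup G) :
    mark R (coset R) * Nat.card R = Nat.card (Subgroup.normalizer (R : Set G)) := by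
  rw [mark_coset]
  exact_mod_cast FinGSet.fixedCard_coset_self_mul_card R

theorem mark_coset_self_ne_zero (R : Subgroup G) : mark R (coset R) ≠ 0 :=
  left_ne_zero_of_mul (b := (Nat.card R : ℤ))
    (by rw [mark_coset_self_mul_card]; exact_mod_cast Nat.card_pos.ne')

theorem exists_map_conj_le_of_mark_coset_ne_zero {Q P : Subgroup G} (h : mark Q (coset P) ≠ 0) :
    ∃ s : G, Q.map (MulAut.conj s).toMonoidHom ≤ P :=
  FinGSet.exists_map_conj_le_of_fixedCard_coset_ne_zero (by rwa [mark_coset, Nat.cast_ne_zero] at h)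

theorem conj_of_mark_coset_ne_zero {Q P : Subgroup G} (h : mark Q (coset P) ≠ 0)
    (hcard : Nat.card P ≤ Nat.card Q) : (subgroupConjSetoid G).r Q P := by
  obtain ⟨s, hs⟩ := exists_map_conj_le_of_mark_coset_ne_zero h
  exact ⟨s, Subgroup.eq_of_le_of_card_ge hs (by rwa [card_map_conj])⟩

theorem coset_eq_of_conj {P Q : Subgroup G} (h : (subgroupConjSetoid G).r P Q) :
    coset P = coset Q := by
  obtain ⟨s, rfl⟩ := h
  rw [coset, coset, FinGSetClass.mk_coset_map_conj]

theorem coset_out (P : Subgroup G) :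
    coset (Quotient.mk (subgroupConjSetoid G) P).out = coset P :=
  coset_eq_of_conj (Quotient.mk_out (s := subgroupConjSetoid G) P)

theorem exists_eq_sum_coset (y : BurnsideRing G) :
    ∃ n : Quotient (subgroupConjSetoid G) → ℤ, y = ∑ᶠ r, n r • coset r.out := by
  have := Fintype.ofFinite (Quotient (subgroupConjSetoid G))
  let V := Submodule.span ℤ (Set.range fun r : Quotient (subgroupConjSetoid G) => coset r.out)
  suffices y ∈ V by
    obtain ⟨c, hc⟩ := (Submodule.mem_span_range_iff_exists_fun ℤ).1 this
    exact ⟨c, by rw [finsum_eq_sum_of_fintype, hc]⟩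
  have of_mem : ∀ m : FinGSetClass G, GrothendieckRing.of m ∈ V := by
    rintro ⟨X⟩
    have hle : AddSubmonoid.closure (Set.range fun P : Subgroup G =>
        FinGSetClass.mk (FinGSet.coset P)) ≤ V.toAddSubmonoid.comap GrothendieckRing.of := by
      refine (AddSubmonoid.closure_le).2 ?_
      rintro _ ⟨P, rfl⟩
      exact Submodule.subset_span ⟨Quotient.mk _ P, coset_out P⟩
    exact hle (FinGSetClass.mk_mem_closure_coset X)
  obtain ⟨a, b, rfl⟩ := GrothendieckRing.exists_sub y
  exact sub_mem (of_mem a) (of_mem b)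

theorem mark_sum_coset_of_card_le (c : Quotient (subgroupConjSetoid G) → ℤ) (Q : Subgroup G)
    (hc : ∀ r, c r ≠ 0 → Nat.card r.out ≤ Nat.card Q) :
    mark Q (∑ᶠ r, c r • coset r.out) = c (Quotient.mk _ Q) * mark Q (coset Q) := by
  have := Fintype.ofFinite (Quotient (subgroupConjSetoid G))
  rw [finsum_eq_sum_of_fintype, map_sum, Finset.sum_eq_single (Quotient.mk _ Q)]
  · rw [map_zsmul, coset_out, smul_eq_mul]
  · intro r _ hr
    rw [map_zsmul, smul_eq_mul, mul_eq_zero]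
    by_contra! h
    refine hr ?_
    rw [← Quotient.out_eq r]
    exact (Quotient.sound (conj_of_mark_coset_ne_zero h.2 (hc r h.1))).symm
  · simp

theorem conj_of_stabilizer_coset {R K : Subgroup G} (x : (FinGSet.coset K).carrier)
    (hx : MulAction.stabilizer G x = R) : (subgroupConjSetoid G).r R K := by
  obtain ⟨s, rfl⟩ := QuotientGroup.mk_surjective (s := K) x
  exact (subgroupConjSetoid G).symm ⟨s, (stabilizer_coset_mk K s).symm.trans hx⟩

theorem moebiusTransform_ghost_coset_self (R : Subgroup G) :
    moebiusTransform R (ghost (coset R)) = mark R (coset R) := by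
  refine moebiusTransform_eq_apply_of_forall_lt R _ fun Q hQ => ?_
  rw [ghost_apply, Int.cast_eq_zero]
  by_contra h
  obtain ⟨s, hs⟩ := exists_map_conj_le_of_mark_coset_ne_zero h
  have hcard := Subgroup.card_le_of_le hs
  rw [card_map_conj] at hcard
  exact hQ.ne (Subgroup.eq_of_le_of_card_ge hQ.le hcard)

theorem moebiusTransform_ghost_coset_of_not_conj {R K : Subgroup G}
    (h : ¬ (subgroupConjSetoid G).r R K) : moebiusTransform R (ghost (coset K)) = 0 := by
  have hghost : ghost (coset K) = fun Q => (FinGSet.fixedCard Q (FinGSet.coset K) : ℚ) := by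
    ext Q
    rw [ghost_apply, mark_coset, Int.cast_natCast]
  have : IsEmpty {x : (FinGSet.coset K).carrier // MulAction.stabilizer G x = R} :=
    ⟨fun x => h (conj_of_stabilizer_coset x.1 x.2)⟩
  rw [hghost, moebiusTransform_fixedCard, Nat.card_of_isEmpty, Nat.cast_zero]

theorem moebiusTransform_sum_smul_ghost_coset (c : Quotient (subgroupConjSetoid G) → ℚ)
    (R : Subgroup G) :
    moebiusTransform R (∑ᶠ r, c r • ghost (coset r.out)) =
      c (Quotient.mk _ R) * mark R (coset R) := by
  have := Fintype.ofFinite (Quotient (subgroupConjSetoid G))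
  rw [finsum_eq_sum_of_fintype, map_sum, Finset.sum_eq_single (Quotient.mk _ R)]
  · rw [map_smul, coset_out, moebiusTransform_ghost_coset_self, smul_eq_mul]
  · intro r _ hr
    rw [map_smul, moebiusTransform_ghost_coset_of_not_conj, smul_zero]
    intro h
    refine hr ?_
    rw [← Quotient.out_eq r]
    exact (Quotient.sound h).symm
  · simp

theorem ghost_sum_coset (n : Quotient (subgroupConjSetoid G) → ℤ) :
    ghost (∑ᶠ r, n r • coset r.out) = ∑ᶠ r, (n r : ℚ) • ghost (coset r.out) := by
  rw [ghost.map_finsum (Set.toFinite _)]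
  simp only [map_zsmul, Int.cast_smul_eq_zsmul]

theorem exists_moebiusTransform_ghost_eq (R : Subgroup G) (y : BurnsideRing G) :
    ∃ n : ℤ, moebiusTransform R (ghost y) = n * mark R (coset R) := by
  obtain ⟨n, rfl⟩ := exists_eq_sum_coset y
  rw [ghost_sum_coset, moebiusTransform_sum_smul_ghost_coset]
  exact ⟨_, rfl⟩

theorem ghost_injective : Function.Injective (ghost : BurnsideRing G →+ (Subgroup G → ℚ)) := by
  refine (injective_iff_map_eq_zero _).2 fun y hy => ?_
  obtain ⟨n, rfl⟩ := exists_eq_sum_coset y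
  refine finsum_eq_zero_of_forall_eq_zero fun r => ?_
  have h := moebiusTransform_sum_smul_ghost_coset (fun r => (n r : ℚ)) r.out
  rw [← ghost_sum_coset, hy, map_zero, Quotient.out_eq] at h
  have hr : n r = 0 := by
    exact_mod_cast (mul_eq_zero.1 h.symm).resolve_right (mod_cast mark_coset_self_ne_zero r.out)
  rw [hr, zero_smul]

end BurnsideRing

/-! ### Marks on the localized Burnside ring -/

namespace ZLocal

variable {p : ℕ} [hp : Fact p.Prime]

theorem inv_natCast_mem {m : ℕ} (hm : ¬ p ∣ m) : (m : ℚ)⁻¹ ∈ ZLocal p := by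
  have h0 : m ≠ 0 := by rintro rfl; exact hm (dvd_zero p)
  change ¬ p ∣ ((m : ℚ)⁻¹).den
  rwa [Rat.inv_natCast_den_of_pos (Nat.pos_of_ne_zero h0)]

theorem div_mem_of_not_dvd {b k : ℕ} (hb : ¬ p * p ^ k ∣ b) :
    ((p ^ k : ℕ) / b : ℚ) ∈ ZLocal p := by
  have hb0 : b ≠ 0 := by rintro rfl; exact hb (dvd_zero _)
  obtain ⟨j, c, hc, rfl⟩ := Nat.exists_eq_pow_mul_and_not_dvd hb0 p hp.out.ne_one
  have hjk : j ≤ k := by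
    by_contra! hlt
    refine hb (Dvd.dvd.mul_right ?_ c)
    rw [← pow_succ']
    exact pow_dvd_pow p hlt
  have hp0 : (p : ℚ) ≠ 0 := by exact_mod_cast hp.out.ne_zero
  have hdiv : ((p ^ k : ℕ) / (p ^ j * c : ℕ) : ℚ) = (p ^ (k - j) : ℕ) * (c : ℚ)⁻¹ := by
    push_cast
    rw [pow_sub₀ _ hp0 hjk, div_eq_mul_inv, mul_inv, mul_assoc]
  rw [hdiv]
  exact mul_mem (natCast_mem _ _) (inv_natCast_mem hc)

theorem exists_common_denominator (z w : ZLocal p) :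
    ∃ u : ZLocal p, u ≠ 0 ∧ ∃ a b : ℤ, z = a • u ∧ w = b • u := by
  have hmul : ¬ p ∣ (z : ℚ).den * (w : ℚ).den := fun h => (hp.out.dvd_mul.1 h).elim z.2 w.2
  refine ⟨⟨_, inv_natCast_mem hmul⟩, fun h => ?_, (z : ℚ).num * (w : ℚ).den,
    (w : ℚ).num * (z : ℚ).den, Subtype.ext ?_, Subtype.ext ?_⟩
  · simpa using congrArg (Subtype.val : ZLocal p → ℚ) h
  · simp only [Nat.cast_mul, mul_inv_rev, zsmul_eq_mul, Int.cast_mul, Int.cast_natCast,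
      Subring.coe_mul, SubringClass.coe_intCast, SubringClass.coe_natCast]
    field_simp
    exact Rat.mul_den_eq_num _
  · simp only [Nat.cast_mul, mul_inv_rev, zsmul_eq_mul, Int.cast_mul, Int.cast_natCast,
      Subring.coe_mul, SubringClass.coe_intCast, SubringClass.coe_natCast]
    field_simp
    exact Rat.mul_den_eq_num _

end ZLocal

namespace LocalBurnsideRing

variable (p : ℕ) [hp : Fact p.Prime] {G : Type u} [Group G]

theorem exists_eq_tmul (X : LocalBurnsideRing p G) :
    ∃ z : ZLocal p, z ≠ 0 ∧ ∃ x : BurnsideRing G, X = z ⊗ₜ x := by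
  induction X using TensorProduct.induction_on with
  | zero => exact ⟨1, one_ne_zero, 0, (TensorProduct.tmul_zero _ _).symm⟩
  | tmul z x =>
    obtain ⟨u, hu, a, -, rfl, -⟩ := ZLocal.exists_common_denominator z z
    exact ⟨u, hu, a • x, TensorProduct.smul_tmul a u x⟩
  | add X Y hX hY =>
    obtain ⟨z, -, x, rfl⟩ := hX
    obtain ⟨w, -, y, rfl⟩ := hY
    obtain ⟨u, hu, a, b, rfl, rfl⟩ := ZLocal.exists_common_denominator z w
    refine ⟨u, hu, a • x + b • y, ?_⟩
    rw [TensorProduct.tmul_add, TensorProduct.smul_tmul, TensorProduct.smul_tmul]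

/-- The ghost map, which records all the marks of an element of the localized Burnside ring. -/
noncomputable def ghost : LocalBurnsideRing p G →ₗ[ZLocal p] (Subgroup G → ℚ) where
  toFun X Q := mark p Q X
  map_add' X Y := by ext; simp
  map_smul' z X := by
    ext Q
    change ((mark p Q (z • X) : ZLocal p) : ℚ) = z * mark p Q X
    rw [map_smul, smul_eq_mul, Subring.coe_mul]

theorem ghost_apply (X : LocalBurnsideRing p G) (Q : Subgroup G) : ghost p X Q = mark p Q X := rfl

theorem ghost_tmul (z : ZLocal p) (x : BurnsideRing G) :
    ghost p (z ⊗ₜ x) = (z : ℚ) • BurnsideRing.ghost x := by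
  ext Q
  simp [ghost_apply, mark, BurnsideRing.ghost_apply]

theorem ghost_mem_range (x : BurnsideRing G) :
    BurnsideRing.ghost x ∈ LinearMap.range (ghost p (G := G)) :=
  ⟨1 ⊗ₜ x, by rw [ghost_tmul, OneMemClass.coe_one, one_smul]⟩

variable [Finite G]

theorem ghost_coset (P : Subgroup G) :
    ghost p (coset p P) = BurnsideRing.ghost (BurnsideRing.coset P) := by
  rw [coset, ghost_tmul, OneMemClass.coe_one, one_smul]

theorem ghost_injective : Function.Injective (ghost p (G := G)) := by
  refine (injective_iff_map_eq_zero _).2 fun X hX => ?_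
  obtain ⟨z, hz, x, rfl⟩ := exists_eq_tmul p X
  rw [ghost_tmul, smul_eq_zero, or_iff_right (by simpa using hz),
    map_eq_zero_iff _ BurnsideRing.ghost_injective] at hX
  rw [hX, TensorProduct.tmul_zero]

theorem exists_eq_sum_coset (X : LocalBurnsideRing p G) :
    ∃ c : Quotient (subgroupConjSetoid G) → ZLocal p, X = ∑ᶠ r, c r • coset p r.out := by
  have := Fintype.ofFinite (Quotient (subgroupConjSetoid G))
  obtain ⟨z, -, x, rfl⟩ := exists_eq_tmul p X
  obtain ⟨n, rfl⟩ := BurnsideRing.exists_eq_sum_coset x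
  refine ⟨fun r => n r • z, ?_⟩
  simp only [finsum_eq_sum_of_fintype, TensorProduct.tmul_sum]
  refine Finset.sum_congr rfl fun r _ => ?_
  rw [coset, TensorProduct.smul_tmul', ← TensorProduct.smul_tmul, smul_eq_mul, mul_one]

theorem coeff_eq_finsum_mark {X : LocalBurnsideRing p G}
    {c : Quotient (subgroupConjSetoid G) → ZLocal p} (hX : X = ∑ᶠ r, c r • coset p r.out)
    (R : Subgroup G) :
    (c (Quotient.mk _ R) : ℚ) = 1 / (BurnsideRing.mark R (BurnsideRing.coset R) : ℚ) *
      ∑ᶠ Q : {Q : Subgroup G // R ≤ Q}, (mark p Q.1 X : ℚ) * (subgroupMoebius R Q.1 : ℚ) := by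
  subst hX
  have hghost : ghost p (∑ᶠ r, c r • coset p r.out) =
      ∑ᶠ r, (c r : ℚ) • BurnsideRing.ghost (BurnsideRing.coset r.out) := by
    refine ((ghost p).toAddMonoidHom.map_finsum (Set.toFinite _)).trans (finsum_congr fun r => ?_)
    change ghost p (c r • coset p r.out) = _
    rw [map_smul, ghost_coset]
    rfl
  have hne : (BurnsideRing.mark R (BurnsideRing.coset R) : ℚ) ≠ 0 :=
    mod_cast BurnsideRing.mark_coset_self_ne_zero R
  change _ = _ * moebiusTransform R (ghost p (∑ᶠ r, c r • coset p r.out))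
  rw [hghost, BurnsideRing.moebiusTransform_sum_smul_ghost_coset]
  field_simp

end LocalBurnsideRing

/-! ### Counting with finite group actions -/

theorem isPGroup_prod {G H : Type*} [Group G] [Group H] [Finite G] [Finite H] {p : ℕ}
    [Fact p.Prime] (hG : IsPGroup p G) (hH : IsPGroup p H) : IsPGroup p (G × H) := by
  obtain ⟨a, ha⟩ := IsPGroup.iff_card.1 hG
  obtain ⟨b, hb⟩ := IsPGroup.iff_card.1 hH
  exact IsPGroup.of_card (n := a + b) (by rw [Nat.card_prod, ha, hb, pow_add])

theorem card_le_card_iff_index_le_index {G : Type*} [Group G] [Finite G] {H K : Subgroup G} :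
    Nat.card H ≤ Nat.card K ↔ K.index ≤ H.index := by
  have hHK : Nat.card H * H.index = Nat.card K * K.index := by
    rw [Subgroup.card_mul_index, Subgroup.card_mul_index]
  have hH : 0 < H.index := Nat.pos_of_ne_zero Subgroup.index_ne_zero_of_finite
  have hK : 0 < Nat.card K := Nat.card_pos
  constructor <;> intro h
  · exact le_of_mul_le_mul_left (hHK ▸ Nat.mul_le_mul_right _ h) hK
  · exact le_of_mul_le_mul_right (hHK ▸ Nat.mul_le_mul_left _ h) hH

theorem card_dvd_card_of_card_le {G : Type*} [Group G] [Finite G] {p : ℕ} [hp : Fact p.Prime]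
    (hG : IsPGroup p G) {H K : Subgroup G} (h : Nat.card H ≤ Nat.card K) :
    Nat.card H ∣ Nat.card K := by
  obtain ⟨a, ha⟩ := IsPGroup.iff_card.1 (hG.to_subgroup H)
  obtain ⟨b, hb⟩ := IsPGroup.iff_card.1 (hG.to_subgroup K)
  rw [ha, hb] at h ⊢
  exact pow_dvd_pow p ((Nat.pow_le_pow_iff_right hp.out.one_lt).1 h)

theorem card_orbit_le_of_not_dvd {G T : Type*} [Group G] [MulAction G T] [Finite T] {p b : ℕ}
    [hp : Fact p.Prime] (hG : IsPGroup p G) (t : T)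
    (h : ¬ p * p ^ b ∣ Nat.card (MulAction.orbit G t)) :
    Nat.card (MulAction.orbit G t) ≤ p ^ b := by
  obtain ⟨a, ha⟩ := hG.card_orbit t
  rw [ha, ← pow_succ'] at h
  rw [ha]
  exact Nat.pow_le_pow_right hp.out.pos
    (Nat.lt_succ_iff.1 (not_le.1 fun hlt => h (pow_dvd_pow p hlt)))

theorem dvd_card_of_dvd_card_orbit {G T : Type*} [Group G] [MulAction G T] [Finite T] {m : ℕ}
    (h : ∀ t : T, m ∣ Nat.card (MulAction.orbit G t)) : m ∣ Nat.card T := by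
  classical
  have := Fintype.ofFinite (MulAction.orbitRel.Quotient G T)
  rw [Nat.card_congr (MulAction.selfEquivSigmaOrbits G T), Nat.card_sigma]
  exact Finset.dvd_sum fun ω _ => h _

theorem dvd_card_setOf_dvd_card_orbit (G T : Type*) [Group G] [MulAction G T] [Finite T] (m : ℕ) :
    m ∣ Nat.card {t : T // m ∣ Nat.card (MulAction.orbit G t)} := by
  let U : SubMulAction G T :=
    { carrier := {t | m ∣ Nat.card (MulAction.orbit G t)}
      smul_mem' := fun g t ht => by
        rwa [Set.mem_ofPred_eq, MulAction.orbit_smul] }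
  refine dvd_card_of_dvd_card_orbit (G := G) (T := U) fun t => ?_
  rw [← Nat.card_image_of_injective Subtype.val_injective, SubMulAction.val_image_orbit]
  exact t.2

theorem dvd_card_setOf_not_dvd_card_orbit (G T : Type*) [Group G] [MulAction G T] [Finite T]
    {m : ℕ} (h : m ∣ Nat.card T) :
    m ∣ Nat.card {t : T // ¬ m ∣ Nat.card (MulAction.orbit G t)} := by
  classical
  have e := Nat.card_congr (Equiv.sumCompl fun t : T => m ∣ Nat.card (MulAction.orbit G t))
  rw [Nat.card_sum] at e
  exact (Nat.dvd_add_right (dvd_card_setOf_dvd_card_orbit G T m)).1 (e ▸ h)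

theorem card_range_normalizerMonoidHom_mul {S : Type u} [Group S] (P : Subgroup S) :
    Nat.card P.normalizerMonoidHom.range * Nat.card (Subgroup.centralizer (P : Set S)) =
      Nat.card (Subgroup.normalizer (P : Set S)) := by
  rw [← Subgroup.index_ker, ← Subgroup.index_mul_card (P.normalizerMonoidHom.ker)]
  congr 1
  rw [Subgroup.normalizerMonoidHom_ker]
  exact (Nat.card_congr (Subgroup.subgroupOfEquivOfLe
    (Subgroup.centralizer_le_normalizer (P : Set S))).toEquiv).symm

namespace FusionSystem

variable {S : Type u} [Group S] (F : FusionSystem S)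

/-! ### Morphisms into `S` -/

/-- The set `F(P, S)` of morphisms from `P` to `S`, as homomorphisms `P → S`. -/
def mor (P : Subgroup S) : Set (P →* S) :=
  {f | ∃ φ ∈ F.Hom P ⊤, (⊤ : Subgroup S).subtype.comp φ = f}

theorem inclusion_mem {P Q : Subgroup S} (h : P ≤ Q) : Subgroup.inclusion h ∈ F.Hom P Q := by
  convert F.conj_mem P Q 1 (fun x hx => by simpa using h hx) using 1
  ext x
  simp [conjHom]

theorem subtype_comp_mem_mor {P Q : Subgroup S} {φ : P →* Q} (h : φ ∈ F.Hom P Q) :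
    Q.subtype.comp φ ∈ F.mor P :=
  ⟨_, F.comp_mem h (F.inclusion_mem le_top), rfl⟩

theorem codRestrict_mem {P Q : Subgroup S} {f : P →* S} (hf : f ∈ F.mor P) (h : ∀ x, f x ∈ Q) :
    f.codRestrict Q h ∈ F.Hom P Q := by
  obtain ⟨φ, hφ, rfl⟩ := hf
  exact F.comp_mem (F.corestrict_mem hφ)
    (F.inclusion_mem (P := ((⊤ : Subgroup S).subtype.comp φ).range) (by
      rintro _ ⟨x, rfl⟩; exact h x))

/-- Morphisms `P → Q` are morphisms `P → S` with image in `Q`. -/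
def homEquiv (P Q : Subgroup S) : F.Hom P Q ≃ {f : F.mor P // ∀ x, f.1 x ∈ Q} where
  toFun φ := ⟨⟨_, F.subtype_comp_mem_mor φ.2⟩, fun x => (φ.1 x).2⟩
  invFun f := ⟨_, F.codRestrict_mem f.1.2 f.2⟩
  left_inv _ := rfl
  right_inv _ := rfl

theorem card_mor (P : Subgroup S) : Nat.card (F.mor P) = Nat.card (F.Hom P ⊤) :=
  Nat.card_congr ((Equiv.subtypeUnivEquiv fun _ _ => Subgroup.mem_top _).symm.trans
    (F.homEquiv P ⊤).symm)

theorem mor_injective {P : Subgroup S} {f : P →* S} (hf : f ∈ F.mor P) :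
    Function.Injective f := by
  obtain ⟨φ, hφ, rfl⟩ := hf
  exact Subtype.val_injective.comp (F.injective hφ)

theorem mor_comp {P Q : Subgroup S} {f : P →* Q} {g : Q →* S} (hf : f ∈ F.Hom P Q)
    (hg : g ∈ F.mor Q) : g.comp f ∈ F.mor P := by
  obtain ⟨φ, hφ, rfl⟩ := hg
  exact ⟨_, F.comp_mem hf hφ, rfl⟩

theorem conj_comp_mem_mor {P : Subgroup S} {f : P →* S} (hf : f ∈ F.mor P) (s : S) :
    (MulAut.conj s).toMonoidHom.comp f ∈ F.mor P := by
  obtain ⟨φ, hφ, rfl⟩ := hf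
  exact ⟨_, F.comp_mem hφ (F.conj_mem ⊤ ⊤ s fun _ _ => Subgroup.mem_top _), rfl⟩

theorem subtype_mem_mor (P : Subgroup S) : P.subtype ∈ F.mor P :=
  F.subtype_comp_mem_mor (F.id_mem P)

theorem mor_restrict {P Q : Subgroup S} {f : Q →* S} (hf : f ∈ F.mor Q) (h : P ≤ Q) :
    f.comp (Subgroup.inclusion h) ∈ F.mor P :=
  F.mor_comp (F.inclusion_mem h) hf

theorem normalizerMonoidHom_mem_aut (P : Subgroup S) (n : Subgroup.normalizer (P : Set S)) :
    P.normalizerMonoidHom n ∈ F.aut P :=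
  F.conj_mem P P n fun x hx => (Subgroup.mem_normalizer_iff.1 n.2 x).1 hx

theorem exists_mulEquiv {P Q : Subgroup S} {f : P →* S} (hf : f ∈ F.mor P) (h : f.range = Q) :
    ∃ e : P ≃* Q, e.toMonoidHom ∈ F.Hom P Q ∧ ∀ x, (e x : S) = f x := by
  have hm : ∀ x, f x ∈ Q := fun x => h ▸ ⟨x, rfl⟩
  refine ⟨MulEquiv.ofBijective (f.codRestrict Q hm) ⟨fun x y hxy => ?_, fun y => ?_⟩,
    F.codRestrict_mem hf hm, fun x => rfl⟩
  · exact F.mor_injective hf (congrArg Subtype.val hxy)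
  · obtain ⟨x, hx⟩ : (y : S) ∈ f.range := h ▸ y.2
    exact ⟨x, Subtype.ext hx⟩

theorem conj_iff {P Q : Subgroup S} : F.Conj P Q ↔ ∃ f ∈ F.mor P, f.range = Q := by
  constructor
  · rintro ⟨φ, hφ, hb⟩
    refine ⟨_, F.subtype_comp_mem_mor hφ, ?_⟩
    rw [MonoidHom.range_comp, MonoidHom.range_eq_top.2 hb.2, ← MonoidHom.range_eq_map,
      Subgroup.range_subtype]
  · rintro ⟨f, hf, h⟩
    obtain ⟨e, he, -⟩ := F.exists_mulEquiv hf h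
    exact ⟨_, he, e.bijective⟩

theorem conj_range {P : Subgroup S} {f : P →* S} (hf : f ∈ F.mor P) : F.Conj P f.range :=
  F.conj_iff.2 ⟨f, hf, rfl⟩

theorem conj_map {P : Subgroup S} {f : P →* S} (hf : f ∈ F.mor P) (Q : Subgroup P) :
    F.Conj (Q.map P.subtype) (Q.map f) := by
  refine F.conj_iff.2 ⟨_, F.mor_restrict hf (Subgroup.map_subtype_le Q), ?_⟩
  ext y
  constructor
  · rintro ⟨⟨_, x, hx, rfl⟩, rfl⟩
    exact ⟨x, hx, rfl⟩
  · rintro ⟨x, hx, rfl⟩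
    exact ⟨⟨_, x, hx, rfl⟩, rfl⟩

theorem Conj.card_eq {F : FusionSystem S} {P Q : Subgroup S} (h : F.Conj P Q) :
    Nat.card P = Nat.card Q := by
  obtain ⟨φ, -, hb⟩ := h
  exact Nat.card_congr (Equiv.ofBijective φ hb)

theorem Conj.symm {F : FusionSystem S} {P Q : Subgroup S} (h : F.Conj P Q) : F.Conj Q P :=
  F.conjSetoid.symm h

theorem Conj.trans {F : FusionSystem S} {P Q R : Subgroup S} (h : F.Conj P Q) (h' : F.Conj Q R) :
    F.Conj P R :=
  F.conjSetoid.trans h h'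

theorem Conj.refl (F : FusionSystem S) (P : Subgroup S) : F.Conj P P :=
  F.conjSetoid.refl P

theorem conj_map_conj (P : Subgroup S) (s : S) :
    F.Conj P (P.map (MulAut.conj s).toMonoidHom) :=
  F.conj_iff.2 ⟨_, F.conj_comp_mem_mor (F.subtype_mem_mor P) s, by
    rw [MonoidHom.range_comp, Subgroup.range_subtype]⟩

variable {F} in
theorem conj_map_conj_iff {P Q : Subgroup S} (s : S) :
    F.Conj P (Q.map (MulAut.conj s).toMonoidHom) ↔ F.Conj P Q :=
  ⟨fun h => h.trans (F.conj_map_conj Q s).symm, fun h => h.trans (F.conj_map_conj Q s)⟩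

variable {F} in
theorem conj_out_iff {P Q : Subgroup S} :
    F.Conj P (Quotient.mk (subgroupConjSetoid S) Q).out ↔ F.Conj P Q := by
  obtain ⟨s, hs⟩ := (subgroupConjSetoid S).symm (Quotient.mk_out (s := subgroupConjSetoid S) Q)
  rw [← hs, conj_map_conj_iff]

theorem exists_aut_of_range_eq {P : Subgroup S} {f g : P →* S} (hf : f ∈ F.mor P)
    (hg : g ∈ F.mor P) (h : f.range = g.range) : ∃ α ∈ F.aut P, ∀ x, f (α x) = g x := by
  obtain ⟨e, he, hev⟩ := F.exists_mulEquiv hf rfl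
  obtain ⟨d, hd, hdv⟩ := F.exists_mulEquiv hg h.symm
  refine ⟨d.trans e.symm, F.comp_mem hd (F.symm_mem e he), fun x => ?_⟩
  rw [← hev, ← hdv]
  simp

theorem range_comp_mulEquiv {P Q : Subgroup S} (f : Q →* S) (e : P ≃* Q) :
    (f.comp e.toMonoidHom).range = f.range := by
  rw [MonoidHom.range_comp, MonoidHom.range_eq_top.2 e.surjective, ← MonoidHom.range_eq_map]

theorem card_hom (Q P : Subgroup S) :
    Nat.card (F.Hom Q P) =
      Nat.card (F.aut Q) * Nat.card {Q' : {Q' : Subgroup S // F.Conj Q Q'} // Q'.1 ≤ P} := by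
  rw [Nat.card_congr (F.homEquiv Q P), ← Nat.card_prod]
  choose f hf hfr using fun Q' : {Q' : Subgroup S // F.Conj Q Q'} => F.conj_iff.1 Q'.2
  symm
  have hrange : ∀ (Q') (α : MulAut Q), ((f Q').comp α.toMonoidHom).range = Q'.1 := fun Q' α => by
    rw [range_comp_mulEquiv, hfr]
  refine Nat.card_congr (Equiv.ofBijective (fun z => ⟨⟨(f z.2.1).comp z.1.1.toMonoidHom,
    F.mor_comp z.1.2 (hf _)⟩, fun x => z.2.2 (hrange z.2.1 z.1.1 ▸ ⟨x, rfl⟩)⟩) ⟨?_, ?_⟩)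
  · rintro ⟨⟨α, hα⟩, ⟨Q₁, h₁⟩⟩ ⟨⟨β, hβ⟩, ⟨Q₂, h₂⟩⟩ h
    have h' : (f Q₁).comp α.toMonoidHom = (f Q₂).comp β.toMonoidHom :=
      congrArg (fun g => g.1.1) h
    have hQ : Q₁ = Q₂ := Subtype.ext (by rw [← hrange Q₁ α, h', hrange])
    subst hQ
    have hαβ : α = β := by
      ext x : 1
      exact F.mor_injective (hf Q₁) (DFunLike.congr_fun h' x)
    subst hαβ
    rfl
  · rintro ⟨⟨g, hg⟩, hgP⟩
    let Q' : {Q' : Subgroup S // F.Conj Q Q'} := ⟨g.range, F.conj_range hg⟩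
    obtain ⟨α, hα, h⟩ := F.exists_aut_of_range_eq (hf Q') hg (hfr Q')
    refine ⟨⟨⟨α, hα⟩, ⟨Q', ?_⟩⟩, ?_⟩
    · rintro _ ⟨x, rfl⟩
      exact hgP x
    · refine Subtype.ext (Subtype.ext ?_)
      ext x
      exact h x

theorem card_mor_eq (Q : Subgroup S) :
    Nat.card (F.mor Q) = Nat.card (F.aut Q) * Nat.card {Q' : Subgroup S // F.Conj Q Q'} := by
  rw [card_mor, card_hom]
  congr 1
  exact Nat.card_congr (Equiv.subtypeUnivEquiv fun _ => le_top)

theorem card_mor_congr {P Q : Subgroup S} (h : F.Conj P Q) :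
    Nat.card (F.mor P) = Nat.card (F.mor Q) := by
  obtain ⟨f, hf, hr⟩ := F.conj_iff.1 h
  obtain ⟨e, he, -⟩ := F.exists_mulEquiv hf hr
  refine Nat.card_congr ⟨fun g => ⟨g.1.comp e.symm.toMonoidHom, F.mor_comp (F.symm_mem e he) g.2⟩,
    fun g => ⟨g.1.comp e.toMonoidHom, F.mor_comp he g.2⟩, fun g => ?_, fun g => ?_⟩
  · ext x; simp
  · ext x; simp

theorem card_hom_congr {P P' : Subgroup S} (Q : Subgroup S) (h : F.Conj P P') :
    Nat.card (F.Hom Q P) = Nat.card (F.Hom Q P') := by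
  obtain ⟨f, hf, hr⟩ := F.conj_iff.1 h
  obtain ⟨e, he, -⟩ := F.exists_mulEquiv hf hr
  refine Nat.card_congr ⟨fun g => ⟨e.toMonoidHom.comp g.1, F.comp_mem g.2 he⟩,
    fun g => ⟨e.symm.toMonoidHom.comp g.1, F.comp_mem g.2 (F.symm_mem e he)⟩,
    fun g => ?_, fun g => ?_⟩
  · refine Subtype.ext ?_
    ext x; simp
  · refine Subtype.ext ?_
    ext x; simp

theorem conj_left_eq {F : FusionSystem S} {Q R : Subgroup S} (h : F.Conj Q R) :
    F.Conj Q = F.Conj R :=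
  funext fun _ => propext ⟨h.symm.trans, h.trans⟩

/-- Restriction of morphisms into `S` to a smaller subgroup. -/
def restrict {P Q : Subgroup S} (h : P ≤ Q) (f : F.mor Q) : F.mor P :=
  ⟨f.1.comp (Subgroup.inclusion h), F.mor_restrict f.2 h⟩

theorem restrict_apply {P Q : Subgroup S} (h : P ≤ Q) (f : F.mor Q) (x : P) :
    (F.restrict h f).1 x = f.1 (Subgroup.inclusion h x) :=
  rfl

theorem exists_restrict_eq {p : ℕ} (hF : F.IsSaturated p) {P M : Subgroup S} (f : F.mor P)
    (hc : F.FullyCentralized f.1.range) (hPM : P ≤ M) (hM : M ≤ extender f.1) :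
    ∃ g, F.restrict hPM g = f := by
  obtain ⟨_, φ, hφ, rfl⟩ := f
  obtain ⟨ψ, hψ, h⟩ := hF.extend P φ hφ hc
  refine ⟨F.restrict hM ⟨_, F.subtype_comp_mem_mor hψ⟩, Subtype.ext ?_⟩
  ext x
  exact congrArg Subtype.val (h x (Subgroup.inclusion hM (Subgroup.inclusion hPM x)) rfl)

theorem exists_fullyCentralized [Finite S] (P : Subgroup S) :
    ∃ Q, F.Conj P Q ∧ F.FullyCentralized Q := by
  have : Nonempty {Q // F.Conj P Q} := ⟨⟨P, Conj.refl F P⟩⟩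
  obtain ⟨Q, hQ⟩ := Finite.exists_max fun Q : {Q // F.Conj P Q} =>
    Nat.card (Subgroup.centralizer (Q.1 : Set S))
  exact ⟨Q.1, Q.2, fun R hR => hQ ⟨R, Q.2.trans hR⟩⟩

theorem exists_fullyNormalized [Finite S] (P : Subgroup S) :
    ∃ Q, F.Conj P Q ∧ F.FullyNormalized Q := by
  have : Nonempty {Q // F.Conj P Q} := ⟨⟨P, Conj.refl F P⟩⟩
  obtain ⟨Q, hQ⟩ := Finite.exists_max fun Q : {Q // F.Conj P Q} =>
    Nat.card (Subgroup.normalizer (Q.1 : Set S))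
  exact ⟨Q.1, Q.2, fun R hR => hQ ⟨R, Q.2.trans hR⟩⟩

theorem mor_ext {P : Subgroup S} {f g : F.mor P} (h : ∀ x, f.1 x = g.1 x) : f = g :=
  Subtype.ext (MonoidHom.ext h)

instance finite_mor [Finite S] (P : Subgroup S) : Finite (F.mor P) :=
  have : Finite (P →* S) := DFunLike.finite _
  inferInstance

end FusionSystem

/-! ### The `p`-part of the number of morphisms -/

namespace FusionSystem

variable {S : Type u} [Group S] {F : FusionSystem S}

section Action

variable {P : Subgroup S}

instance morMulAction : MulAction S (F.mor P) where
  smul s f := ⟨(MulAut.conj s).toMonoidHom.comp f.1, F.conj_comp_mem_mor f.2 s⟩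
  one_smul f := F.mor_ext fun x => by
    change 1 * f.1 x * 1⁻¹ = f.1 x
    group
  mul_smul s t f := F.mor_ext fun x => by
    change (s * t) * f.1 x * (s * t)⁻¹ = s * (t * f.1 x * t⁻¹) * s⁻¹
    group

theorem smul_apply (s : S) (f : F.mor P) (x : P) : (s • f).1 x = s * f.1 x * s⁻¹ :=
  rfl

instance morProdMulAction : MulAction (S × Subgroup.normalizer (P : Set S)) (F.mor P) where
  smul g f := g.1 • ⟨f.1.comp (P.normalizerMonoidHom g.2⁻¹).toMonoidHom,
    F.mor_comp (F.normalizerMonoidHom_mem_aut P _) f.2⟩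
  one_smul f := F.mor_ext fun x => by
    change 1 * f.1 (P.normalizerMonoidHom 1⁻¹ x) * 1⁻¹ = f.1 x
    simp
  mul_smul g h f := F.mor_ext fun x => by
    change (g.1 * h.1) * f.1 (P.normalizerMonoidHom (g.2 * h.2)⁻¹ x) * (g.1 * h.1)⁻¹ =
      g.1 * (h.1 * f.1 (P.normalizerMonoidHom h.2⁻¹ (P.normalizerMonoidHom g.2⁻¹ x)) * h.1⁻¹) *
        g.1⁻¹
    rw [mul_inv_rev, map_mul, MulAut.mul_apply]
    group

theorem stabilizer_mor (f : F.mor P) :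
    MulAction.stabilizer S f = Subgroup.centralizer (f.1.range : Set S) := by
  ext s
  constructor
  · rintro hs _ ⟨x, rfl⟩
    exact (mul_inv_eq_iff_eq_mul.1 (congrArg (fun a : F.mor P => a.1 x) hs)).symm
  · intro hs
    refine F.mor_ext fun x => ?_
    rw [smul_apply, ← hs (f.1 x) ⟨x, rfl⟩, mul_inv_cancel_right]

theorem card_orbit_mor (f : F.mor P) :
    Nat.card (MulAction.orbit S f) = (Subgroup.centralizer (f.1.range : Set S)).index := by
  rw [← stabilizer_mor, MulAction.index_stabilizer]
  rfl

theorem orbit_subset_orbit_prod (f : F.mor P) :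
    MulAction.orbit S f ⊆ MulAction.orbit (S × Subgroup.normalizer (P : Set S)) f := by
  rintro _ ⟨s, rfl⟩
  refine ⟨(s, 1), F.mor_ext fun x => ?_⟩
  change s * f.1 (P.normalizerMonoidHom 1⁻¹ x) * s⁻¹ = s * f.1 x * s⁻¹
  simp

theorem orbit_prod_restrict (g : F.mor (Subgroup.normalizer (P : Set S))) :
    MulAction.orbit (S × Subgroup.normalizer (P : Set S))
        (F.restrict Subgroup.le_normalizer g : F.mor P) =
      MulAction.orbit S (F.restrict Subgroup.le_normalizer g) := by
  refine (Set.Subset.antisymm ?_ (orbit_subset_orbit_prod _))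
  rintro _ ⟨⟨s, n⟩, rfl⟩
  refine ⟨s * g.1 n⁻¹, F.mor_ext fun x => ?_⟩
  have hconj : Subgroup.inclusion Subgroup.le_normalizer (P.normalizerMonoidHom n⁻¹ x) =
      n⁻¹ * Subgroup.inclusion (Subgroup.le_normalizer (H := P)) x * n := by
    refine Subtype.ext ?_
    change (n : S)⁻¹ * x * (n : S)⁻¹⁻¹ = (n : S)⁻¹ * x * n
    rw [inv_inv]
  change (s * g.1 n⁻¹) * g.1 (Subgroup.inclusion Subgroup.le_normalizer x) * (s * g.1 n⁻¹)⁻¹ =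
    s * g.1 (Subgroup.inclusion Subgroup.le_normalizer (P.normalizerMonoidHom n⁻¹ x)) * s⁻¹
  rw [hconj, map_mul, map_mul, map_inv]
  group

theorem normalizer_le_extender {f : F.mor P}
    (h : MulAction.orbit (S × Subgroup.normalizer (P : Set S)) f ⊆ MulAction.orbit S f) :
    Subgroup.normalizer (P : Set S) ≤ extender f.1 := by
  intro n hn
  obtain ⟨s, hs⟩ := h (MulAction.mem_orbit f
    ((1, ⟨n, hn⟩⁻¹) : S × Subgroup.normalizer (P : Set S)))
  refine ⟨hn, s, fun x y hxy => ?_⟩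
  have hx : s * f.1 x * s⁻¹ = 1 * f.1 (P.normalizerMonoidHom ⟨n, hn⟩⁻¹⁻¹ x) * 1⁻¹ :=
    congrArg (fun a : F.mor P => a.1 x) hs
  rw [inv_inv, inv_one, one_mul, mul_one] at hx
  rw [hx]
  exact congrArg f.1 (Subtype.ext hxy)

end Action

/-- The subgroup of automorphisms of `N` in the fusion system that fix `N ∩ P` pointwise. -/
def autFixing (F : FusionSystem S) (N P : Subgroup S) : Subgroup (MulAut N) where
  carrier := {κ | κ ∈ F.aut N ∧ ∀ x : N, (x : S) ∈ P → κ x = x}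
  one_mem' := ⟨one_mem _, fun _ _ => rfl⟩
  mul_mem' := fun {a b} ha hb => ⟨mul_mem ha.1 hb.1, fun x hx => by
    rw [MulAut.mul_apply, hb.2 x hx, ha.2 x hx]⟩
  inv_mem' := fun {a} ha => ⟨inv_mem ha.1, fun x hx => by
    rw [MulAut.inv_apply, MulEquiv.symm_apply_eq, ha.2 x hx]⟩

theorem card_centralizer_dvd (F : FusionSystem S) (P : Subgroup S) :
    Nat.card (Subgroup.centralizer (P : Set S)) ∣
      Nat.card (F.autFixing (Subgroup.normalizer (P : Set S)) P) *
        Nat.card (Subgroup.centralizer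
          ((Subgroup.normalizer (P : Set S) : Subgroup S) : Set S)) := by
  set N : Subgroup S := Subgroup.normalizer (P : Set S)
  have hCN : Subgroup.centralizer (P : Set S) ≤ N :=
    Subgroup.centralizer_le_normalizer (P : Set S)
  let c : Subgroup.centralizer (P : Set S) →* MulAut N :=
    MulAut.conj.comp (Subgroup.inclusion hCN)
  have hrange : c.range ≤ F.autFixing N P := by
    rintro _ ⟨x, rfl⟩
    refine ⟨F.conj_mem N N x fun y hy => mul_mem (mul_mem (hCN x.2) hy) (inv_mem (hCN x.2)),
      fun y hy => Subtype.ext ?_⟩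
    change (x : S) * y * (x : S)⁻¹ = y
    rw [← x.2 y hy, mul_inv_cancel_right]
  have hker : c.ker.map (Subgroup.subtype _) ≤ Subgroup.centralizer (N : Set S) := by
    rintro _ ⟨x, hx, rfl⟩ y hy
    have hxy : (x : S) * y * (x : S)⁻¹ = y :=
      congrArg Subtype.val (DFunLike.congr_fun (MonoidHom.mem_ker.1 hx) (⟨y, hy⟩ : N))
    exact (mul_inv_eq_iff_eq_mul.1 hxy).symm
  rw [← Subgroup.index_mul_card c.ker, Subgroup.index_ker,
    ← Subgroup.card_map_of_injective (K := c.ker) (Subgroup.subtype_injective _)]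
  exact mul_dvd_mul (Subgroup.card_dvd_of_le hrange) (Subgroup.card_dvd_of_le hker)

/-- The homomorphism `N_S(Q) → Aut_F(P)`, `n ↦ e c_n e⁻¹`, for an isomorphism `e : Q → P` in the
fusion system. -/
def conjAutomizer {P Q : Subgroup S} (e : Q ≃* P) (he : e.toMonoidHom ∈ F.Hom Q P) :
    Subgroup.normalizer (Q : Set S) →* F.aut P where
  toFun n := ⟨(e.symm.trans (Q.normalizerMonoidHom n)).trans e,
    F.comp_mem (F.comp_mem (F.symm_mem e he) (F.normalizerMonoidHom_mem_aut Q n)) he⟩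
  map_one' := Subtype.ext (MulEquiv.ext fun x => by simp)
  map_mul' a b := Subtype.ext (MulEquiv.ext fun x => by simp)

theorem normalizer_le_extender_of_conjAutomizer_mem {P Q : Subgroup S} {e : Q ≃* P}
    {he : e.toMonoidHom ∈ F.Hom Q P}
    (h : ∀ n, (conjAutomizer e he n).1 ∈ P.normalizerMonoidHom.range) :
    Subgroup.normalizer (Q : Set S) ≤ extender (P.subtype.comp e.toMonoidHom) := by
  intro n hn
  obtain ⟨y, hy⟩ := h ⟨n, hn⟩
  refine ⟨hn, y, fun a b hab => ?_⟩
  have hb : Q.normalizerMonoidHom ⟨n, hn⟩ a = b := Subtype.ext hab.symm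
  have hyb : P.normalizerMonoidHom y (e a) = e b := by
    rw [hy, ← hb]
    exact congrArg (fun z => e (Q.normalizerMonoidHom ⟨n, hn⟩ z)) (e.symm_apply_apply a)
  exact congrArg Subtype.val hyb.symm

variable [Finite S]

namespace FullyCentralized

variable {P : Subgroup S} (hP : F.FullyCentralized P)
include hP

theorem index_centralizer_le_card_orbit (f : F.mor P) :
    (Subgroup.centralizer (P : Set S)).index ≤ Nat.card (MulAction.orbit S f) := by
  rw [card_orbit_mor, ← card_le_card_iff_index_le_index]
  exact hP _ (F.conj_range f.2)

theorem range_of_card_orbit_le {f : F.mor P}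
    (h : Nat.card (MulAction.orbit S f) ≤ (Subgroup.centralizer (P : Set S)).index) :
    F.FullyCentralized f.1.range := by
  rw [card_orbit_mor, ← card_le_card_iff_index_le_index] at h
  exact fun R hR => (hP R ((F.conj_range f.2).trans hR)).trans h

/-- A morphism defined on `N_S(P)` maps `C_S(P)` into the centralizer of the image of `P`, and
`C_S(P)` is as large as possible. -/
theorem map_centralizer (g : F.mor (Subgroup.normalizer (P : Set S))) :
    ((Subgroup.centralizer (P : Set S)).subgroupOf (Subgroup.normalizer (P : Set S))).map g.1 =
      Subgroup.centralizer ((F.restrict Subgroup.le_normalizer g : F.mor P).1.range : Set S) := by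
  refine Subgroup.eq_of_le_of_card_ge ?_ ?_
  · rintro _ ⟨x, hx, rfl⟩ _ ⟨y, rfl⟩
    have hxy : (y : S) * x = x * y := Subgroup.mem_subgroupOf.1 hx y y.2
    rw [restrict_apply, ← map_mul, ← map_mul]
    exact congrArg g.1 (Subtype.ext hxy)
  · rw [Subgroup.card_map_of_injective (F.mor_injective g.2),
      Nat.card_congr (Subgroup.subgroupOfEquivOfLe
        (Subgroup.centralizer_le_normalizer (P : Set S))).toEquiv]
    exact hP _ (F.conj_range (F.restrict _ g).2)

theorem card_orbit_prod_restrict_le (g : F.mor (Subgroup.normalizer (P : Set S))) :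
    Nat.card (MulAction.orbit (S × Subgroup.normalizer (P : Set S))
      (F.restrict Subgroup.le_normalizer g : F.mor P)) ≤
        (Subgroup.centralizer (P : Set S)).index := by
  rw [orbit_prod_restrict, card_orbit_mor, ← card_le_card_iff_index_le_index,
    ← hP.map_centralizer g, Subgroup.card_map_of_injective (F.mor_injective g.2),
    Nat.card_congr (Subgroup.subgroupOfEquivOfLe
      (Subgroup.centralizer_le_normalizer (P : Set S))).toEquiv]

theorem range_le_range {g h : F.mor (Subgroup.normalizer (P : Set S))}
    (hgh : (F.restrict Subgroup.le_normalizer g : F.mor P) = F.restrict Subgroup.le_normalizer h) :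
    g.1.range ≤ h.1.range := by
  rintro _ ⟨n, rfl⟩
  have hmul : ∀ (k : F.mor (Subgroup.normalizer (P : Set S))) (x y : P), (y : S) * n = n * x →
      (F.restrict Subgroup.le_normalizer k : F.mor P).1 y * k.1 n =
        k.1 n * (F.restrict Subgroup.le_normalizer k : F.mor P).1 x := by
    intro k x y hxy
    rw [restrict_apply, restrict_apply, ← map_mul, ← map_mul]
    exact congrArg k.1 (Subtype.ext hxy)
  have hcent : g.1 n * (h.1 n)⁻¹ ∈ Subgroup.centralizer
      ((F.restrict Subgroup.le_normalizer h : F.mor P).1.range : Set S) := by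
    rintro _ ⟨y, rfl⟩
    obtain ⟨x, hxy⟩ : ∃ x : P, (y : S) * n = n * x :=
      ⟨⟨(n : S)⁻¹ * y * n, by
        simpa only [inv_inv] using (Subgroup.mem_normalizer_iff.1 (inv_mem n.2) y).1 y.2⟩,
        by group⟩
    have hg := hmul g x y hxy
    rw [hgh] at hg
    rw [← mul_assoc, hg, mul_assoc, mul_assoc, mul_right_inj, eq_inv_mul_iff_mul_eq,
      ← mul_assoc, ← hmul h x y hxy, mul_inv_cancel_right]
  rw [← hP.map_centralizer h] at hcent
  obtain ⟨z, -, hz⟩ := hcent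
  exact ⟨z * n, by rw [map_mul, hz, inv_mul_cancel_right]⟩

theorem card_extensions (g : F.mor (Subgroup.normalizer (P : Set S))) :
    Nat.card {h : F.mor (Subgroup.normalizer (P : Set S)) //
        (F.restrict Subgroup.le_normalizer h : F.mor P) = F.restrict Subgroup.le_normalizer g} =
      Nat.card (F.autFixing (Subgroup.normalizer (P : Set S)) P) := by
  symm
  refine Nat.card_congr (Equiv.ofBijective (fun κ => ⟨⟨g.1.comp κ.1.toMonoidHom,
    F.mor_comp κ.2.1 g.2⟩, F.mor_ext fun x => congrArg g.1 (κ.2.2 _ x.2)⟩) ⟨?_, ?_⟩)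
  · intro κ κ' h
    have hcomp : g.1.comp κ.1.toMonoidHom = g.1.comp κ'.1.toMonoidHom :=
      congrArg (fun a => a.1.1) h
    exact Subtype.ext (MulEquiv.ext fun x =>
      F.mor_injective g.2 (DFunLike.congr_fun hcomp x))
  · rintro ⟨h, hhg⟩
    obtain ⟨κ, hκ, hκh⟩ := F.exists_aut_of_range_eq g.2 h.2
      (le_antisymm (hP.range_le_range hhg.symm) (hP.range_le_range hhg))
    refine ⟨⟨κ, hκ, fun x hx => F.mor_injective g.2 ?_⟩, Subtype.ext (F.mor_ext hκh)⟩
    rw [hκh]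
    exact congrArg (fun a : F.mor P => a.1 ⟨x, hx⟩) hhg

end FullyCentralized

variable {p : ℕ} [hp : Fact p.Prime]

theorem FullyCentralized.exists_restrict_eq_iff (hS : IsPGroup p S) (hF : F.IsSaturated p)
    {P : Subgroup S} (hP : F.FullyCentralized P) (f : F.mor P) :
    (∃ g : F.mor (Subgroup.normalizer (P : Set S)), F.restrict Subgroup.le_normalizer g = f) ↔
      ¬ p * (Subgroup.centralizer (P : Set S)).index ∣
        Nat.card (MulAction.orbit (S × Subgroup.normalizer (P : Set S)) f) := by
  constructor
  · rintro ⟨g, rfl⟩ hdvd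
    have hpos : 0 < (Subgroup.centralizer (P : Set S)).index :=
      Nat.pos_of_ne_zero Subgroup.index_ne_zero_of_finite
    have : Nonempty (MulAction.orbit (S × Subgroup.normalizer (P : Set S))
        (F.restrict Subgroup.le_normalizer g : F.mor P)) := (MulAction.nonempty_orbit _).to_subtype
    have hle := (Nat.le_of_dvd Nat.card_pos hdvd).trans (hP.card_orbit_prod_restrict_le g)
    exact hle.not_gt (lt_mul_of_one_lt_left hpos hp.out.one_lt)
  · intro hdvd
    have hle : Nat.card (MulAction.orbit (S × Subgroup.normalizer (P : Set S)) f) ≤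
        (Subgroup.centralizer (P : Set S)).index := by
      obtain ⟨b, hb⟩ := hS.index (Subgroup.centralizer (P : Set S))
      rw [hb] at hdvd ⊢
      exact card_orbit_le_of_not_dvd (isPGroup_prod hS (hS.to_subgroup _)) f hdvd
    have heq : MulAction.orbit S f =
        MulAction.orbit (S × Subgroup.normalizer (P : Set S)) f :=
      Set.eq_of_subset_of_ncard_le (orbit_subset_orbit_prod f)
        (hle.trans (hP.index_centralizer_le_card_orbit f))
    exact F.exists_restrict_eq hF f (hP.range_of_card_orbit_le (heq ▸ hle)) _
      (normalizer_le_extender heq.ge)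

theorem FullyCentralized.card_mor_normalizer (hS : IsPGroup p S) (hF : F.IsSaturated p)
    {P : Subgroup S} (hP : F.FullyCentralized P) :
    Nat.card (F.mor (Subgroup.normalizer (P : Set S))) =
      Nat.card {f : F.mor P // ¬ p * (Subgroup.centralizer (P : Set S)).index ∣
        Nat.card (MulAction.orbit (S × Subgroup.normalizer (P : Set S)) f)} *
      Nat.card (F.autFixing (Subgroup.normalizer (P : Set S)) P) := by
  let res (g : F.mor (Subgroup.normalizer (P : Set S))) :
      {f : F.mor P // ¬ p * (Subgroup.centralizer (P : Set S)).index ∣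
        Nat.card (MulAction.orbit (S × Subgroup.normalizer (P : Set S)) f)} :=
    ⟨F.restrict Subgroup.le_normalizer g, (hP.exists_restrict_eq_iff hS hF _).1 ⟨g, rfl⟩⟩
  have hfibre : ∀ f, Nat.card {g // res g = f} =
      Nat.card (F.autFixing (Subgroup.normalizer (P : Set S)) P) := by
    rintro ⟨f, hf⟩
    obtain ⟨g, rfl⟩ := (hP.exists_restrict_eq_iff hS hF f).2 hf
    rw [← hP.card_extensions g]
    exact Nat.card_congr (Equiv.subtypeEquivRight fun h => Subtype.ext_iff)
  have := Fintype.ofFinite {f : F.mor P // ¬ p * (Subgroup.centralizer (P : Set S)).index ∣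
    Nat.card (MulAction.orbit (S × Subgroup.normalizer (P : Set S)) f)}
  rw [← Nat.card_congr (Equiv.sigmaFiberEquiv res), Nat.card_sigma,
    Finset.sum_const_nat fun f _ => hfibre f, Finset.card_univ, ← Nat.card_eq_fintype_card]

theorem not_dvd_card_mor_top (hF : F.IsSaturated p) :
    ¬ p * Nat.card S ∣ Nat.card (F.mor ⊤) *
      Nat.card (Subgroup.centralizer ((⊤ : Subgroup S) : Set S)) := by
  have hfn : F.FullyNormalized ⊤ := fun R _ => by
    rw [Subgroup.normalizer_eq_top (⊤ : Subgroup S), Subgroup.card_top]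
    exact Subgroup.card_le_card_group _
  obtain ⟨-, T, hT⟩ := hF.sylow ⊤ hfn
  have hcardT : Nat.card T = Nat.card (⊤ : Subgroup S).normalizerMonoidHom.range := by
    rw [← hT]
    exact (Subgroup.card_map_of_injective Subtype.val_injective).symm
  have hcardS := card_range_normalizerMonoidHom_mul (⊤ : Subgroup S)
  rw [← hcardT, Subgroup.normalizer_eq_top, Subgroup.card_top] at hcardS
  have : Unique {Q : Subgroup S // F.Conj ⊤ Q} :=
    { default := ⟨⊤, Conj.refl F ⊤⟩
      uniq := fun Q => Subtype.ext (Subgroup.eq_top_of_card_eq _ (by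
        rw [← Q.2.card_eq, Subgroup.card_top])) }
  rw [← hcardS, card_mor_eq, Nat.card_unique (α := {Q : Subgroup S // F.Conj ⊤ Q}), mul_one,
    ← mul_assoc]
  intro hdvd
  have hdvdT := Nat.dvd_of_mul_dvd_mul_right Nat.card_pos hdvd
  rw [← Subgroup.card_mul_index (T : Subgroup (F.aut ⊤)), mul_comm p] at hdvdT
  exact T.not_dvd_index (Nat.dvd_of_mul_dvd_mul_left Nat.card_pos hdvdT)

/-- Removing the orbits of size divisible by `p |S : C_S(P)|` leaves the morphisms that extend to
`N_S(P)`. -/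
theorem FullyCentralized.dvd_card_mor_normalizer (hS : IsPGroup p S) (hF : F.IsSaturated p)
    {P : Subgroup S} (hP : F.FullyCentralized P)
    (h : p * Nat.card S ∣ Nat.card (F.mor P) * Nat.card (Subgroup.centralizer (P : Set S))) :
    p * Nat.card S ∣ Nat.card (F.mor (Subgroup.normalizer (P : Set S))) *
      Nat.card (Subgroup.centralizer
        ((Subgroup.normalizer (P : Set S) : Subgroup S) : Set S)) := by
  rw [← Subgroup.index_mul_card (Subgroup.centralizer (P : Set S)), ← mul_assoc] at h ⊢
  rw [hP.card_mor_normalizer hS hF, mul_assoc (Nat.card {f : F.mor P // _})]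
  exact mul_dvd_mul (dvd_card_setOf_not_dvd_card_orbit _ _
    (Nat.dvd_of_mul_dvd_mul_right Nat.card_pos h)) (F.card_centralizer_dvd P)

theorem not_dvd_card_mor (hS : IsPGroup p S) (hF : F.IsSaturated p) (P : Subgroup S) :
    ¬ p * Nat.card S ∣ Nat.card (F.mor P) * Nat.card (Subgroup.centralizer (P : Set S)) := by
  induction h : Nat.card S - Nat.card P using Nat.strong_induction_on generalizing P with
  | _ n ih =>
    subst h
    intro hdvd
    obtain ⟨Q, hPQ, hQ⟩ := F.exists_fullyCentralized P
    have hdvdQ : p * Nat.card S ∣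
        Nat.card (F.mor Q) * Nat.card (Subgroup.centralizer (Q : Set S)) := by
      rw [← F.card_mor_congr hPQ]
      exact hdvd.trans (mul_dvd_mul_left _ (card_dvd_card_of_card_le hS (hQ P hPQ.symm)))
    rcases eq_or_ne Q ⊤ with rfl | hne
    · exact not_dvd_card_mor_top hF hdvdQ
    · have := hS.isNilpotent
      have hlt : Nat.card Q < Nat.card (Subgroup.normalizer (Q : Set S)) :=
        Set.ncard_lt_ncard
          (Group.normalizerCondition_of_isNilpotent Q (lt_top_iff_ne_top.2 hne))
      have hle := Subgroup.card_le_card_group (Subgroup.normalizer (Q : Set S))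
      refine ih _ ?_ (Subgroup.normalizer (Q : Set S)) rfl
        (hQ.dvd_card_mor_normalizer hS hF hdvdQ)
      rw [hPQ.card_eq]
      omega

theorem not_dvd_card_conj (hS : IsPGroup p S) (hF : F.IsSaturated p) (P : Subgroup S) :
    ¬ p * Nat.card S ∣ Nat.card {Q : Subgroup S // F.Conj P Q} *
      Nat.card (Subgroup.normalizer (P : Set S)) := by
  intro h
  refine not_dvd_card_mor hS hF P (h.trans ?_)
  rw [card_mor_eq, ← card_range_normalizerMonoidHom_mul, mul_comm (Nat.card (F.aut P)), mul_assoc]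
  refine mul_dvd_mul_left _ (mul_dvd_mul_right (Subgroup.card_dvd_of_le ?_) _)
  rintro _ ⟨n, rfl⟩
  exact F.normalizerMonoidHom_mem_aut P n

theorem FullyNormalized.exists_conjAutomizer_mem (hS : IsPGroup p S) (hF : F.IsSaturated p)
    {P Q : Subgroup S} (hP : F.FullyNormalized P) (hQP : F.Conj Q P) :
    ∃ (e : Q ≃* P) (he : e.toMonoidHom ∈ F.Hom Q P),
      ∀ n, (conjAutomizer e he n).1 ∈ P.normalizerMonoidHom.range := by
  obtain ⟨-, T, hT⟩ := hF.sylow P hP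
  obtain ⟨f, hf, hr⟩ := F.conj_iff.1 hQP
  obtain ⟨e, he, -⟩ := F.exists_mulEquiv hf hr
  have hrange : IsPGroup p (conjAutomizer e he).range :=
    (hS.to_subgroup _).of_surjective _ (conjAutomizer e he).rangeRestrict_surjective
  obtain ⟨T', hT'⟩ := hrange.exists_le_sylow
  obtain ⟨χ, hχ⟩ := MulAction.exists_smul_eq (F.aut P) T' T
  refine ⟨e.trans χ.1, F.comp_mem he χ.2, fun n => ?_⟩
  rw [← hT, ← hχ]
  exact ⟨χ * conjAutomizer e he n * χ⁻¹, ⟨_, hT' ⟨n, rfl⟩, rfl⟩, rfl⟩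

theorem FullyNormalized.exists_mor_normalizer (hS : IsPGroup p S) (hF : F.IsSaturated p)
    {P Q : Subgroup S} (hP : F.FullyNormalized P) (hQP : F.Conj Q P) :
    ∃ f ∈ F.mor (Subgroup.normalizer (Q : Set S)),
      (Q.subgroupOf (Subgroup.normalizer (Q : Set S))).map f = P := by
  obtain ⟨e, he, hext⟩ := hP.exists_conjAutomizer_mem hS hF hQP
  have hrange : (P.subtype.comp e.toMonoidHom).range = P := by
    rw [range_comp_mulEquiv, Subgroup.range_subtype]
  obtain ⟨g, hg⟩ := F.exists_restrict_eq hF ⟨_, F.subtype_comp_mem_mor he⟩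
    (by rw [hrange]; exact (hF.sylow P hP).1) Subgroup.le_normalizer
    (normalizer_le_extender_of_conjAutomizer_mem hext)
  refine ⟨g.1, g.2, ?_⟩
  rw [← Subgroup.inclusion_range Subgroup.le_normalizer, ← MonoidHom.range_comp]
  exact (congrArg (fun a : F.mor Q => a.1.range) hg).trans hrange

end FusionSystem

/-! ### Integral stabilization -/

open scoped Pointwise in
theorem card_conj_class_eq_index {S : Type u} [Group S] (K : Subgroup S) :
    Nat.card {R : Subgroup S // (subgroupConjSetoid S).r K R} =
      (Subgroup.normalizer (K : Set S)).index := by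
  let : MulAction S (Subgroup S) := MulAction.compHom (Subgroup S) (MulAut.conj (G := S))
  have h : Subgroup.normalizer (K : Set S) = MulAction.stabilizer S K := by
    ext s
    exact Subgroup.mem_normalizer_iff_map_conj_eq
  rw [h, MulAction.index_stabilizer]
  rfl

theorem sum_subgroup_eq_sum_class {S : Type u} [Group S] [Finite S] {M : Type*} [AddCommMonoid M]
    [Fintype (Subgroup S)] [Fintype (Quotient (subgroupConjSetoid S))] {g : Subgroup S → M}
    (hg : ∀ R s, g (R.map (MulAut.conj s).toMonoidHom) = g R) :
    ∑ R, g R = ∑ r : Quotient (subgroupConjSetoid S),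
      (Subgroup.normalizer (r.out : Set S)).index • g r.out := by
  classical
  rw [← Finset.sum_fiberwise Finset.univ (fun R => Quotient.mk (subgroupConjSetoid S) R) g]
  refine Finset.sum_congr rfl fun r _ => ?_
  have hconj : ∀ R : Subgroup S, Quotient.mk (subgroupConjSetoid S) R = r ↔
      (subgroupConjSetoid S).r r.out R := fun R => by
    conv_lhs => rw [← Quotient.out_eq r]
    exact Quotient.eq.trans ⟨(subgroupConjSetoid S).symm, (subgroupConjSetoid S).symm⟩
  rw [Finset.sum_congr rfl (g := fun _ => g r.out), Finset.sum_const]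
  · rw [← card_conj_class_eq_index,
      Nat.card_eq_fintype_card (α := {R : Subgroup S // (subgroupConjSetoid S).r r.out R}),
      Fintype.card_subtype]
    simp only [hconj]
  · intro R hR
    obtain ⟨s, hs⟩ := (hconj R).1 (Finset.mem_filter.1 hR).2
    rw [← hs, hg]

namespace FusionSystem

variable {S : Type u} [Group S] {F : FusionSystem S}

theorem mark_eq_of_mem_burnsideRing {x : BurnsideRing S} (hx : x ∈ F.burnsideRing)
    {Q Q' : Subgroup S} (h : F.Conj Q Q') : BurnsideRing.mark Q' x = BurnsideRing.mark Q x := by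
  obtain ⟨_, ⟨φ, hφ, rfl⟩, rfl⟩ := F.conj_iff.1 h
  have := congrArg (BurnsideRing.mark ⊤) (hx Q φ hφ)
  rwa [BurnsideRing.mark_res, BurnsideRing.mark_res, ← MonoidHom.range_eq_map,
    ← MonoidHom.range_eq_map, Subgroup.range_subtype] at this

variable [Finite S]

theorem mem_burnsideRing_of_mark_eq {x : BurnsideRing S}
    (h : ∀ Q Q', F.Conj Q Q' → BurnsideRing.mark Q' x = BurnsideRing.mark Q x) :
    x ∈ F.burnsideRing := by
  refine fun P φ hφ => BurnsideRing.ghost_injective (funext fun Q => ?_)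
  rw [BurnsideRing.ghost_apply, BurnsideRing.ghost_apply, BurnsideRing.mark_res,
    BurnsideRing.mark_res, h _ _ (F.conj_map ⟨φ, hφ, rfl⟩ Q)]

variable (F) in
/-- The marks of `x` are `F`-stable on the subgroups of order at least `n`. -/
def StableFrom (n : ℕ) (x : BurnsideRing S) : Prop :=
  ∀ Q Q' : Subgroup S, n ≤ Nat.card Q → F.Conj Q Q' → BurnsideRing.mark Q' x = BurnsideRing.mark Q x

theorem mark_coset_subgroupOf_normalizer (Q : Subgroup S) :
    BurnsideRing.mark (Q.subgroupOf (Subgroup.normalizer (Q : Set S)))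
        (BurnsideRing.coset (Q.subgroupOf (Subgroup.normalizer (Q : Set S)))) =
      BurnsideRing.mark Q (BurnsideRing.coset Q) := by
  have hnormal : (Q.subgroupOf (Subgroup.normalizer (Q : Set S))).Normal :=
    Subgroup.normal_in_normalizer
  have hcard : Nat.card (Q.subgroupOf (Subgroup.normalizer (Q : Set S))) = Nat.card Q :=
    Nat.card_congr (Subgroup.subgroupOfEquivOfLe Subgroup.le_normalizer).toEquiv
  refine mul_right_cancel₀ (b := (Nat.card Q : ℤ)) (Nat.cast_ne_zero.2 Nat.card_pos.ne') ?_
  rw [BurnsideRing.mark_coset_self_mul_card Q, ← hcard, BurnsideRing.mark_coset_self_mul_card,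
    (Q.subgroupOf (Subgroup.normalizer (Q : Set S))).normalizer_eq_top, Subgroup.card_top]

/-- Restricting `x` to `N_S(Q)` along the inclusion and along an extension `N_S(Q) → S` of an
isomorphism `Q → P` gives two elements with the same marks above `Q`, so the congruence for
the Möbius transform at `Q` compares their marks at `Q`. -/
theorem StableFrom.mark_coset_dvd {p : ℕ} [Fact p.Prime] (hS : IsPGroup p S)
    (hF : F.IsSaturated p) {P Q : Subgroup S} (hP : F.FullyNormalized P) (hQP : F.Conj Q P)
    {x : BurnsideRing S} (hx : F.StableFrom (Nat.card P + 1) x) :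
    BurnsideRing.mark Q (BurnsideRing.coset Q) ∣
      BurnsideRing.mark P x - BurnsideRing.mark Q x := by
  have hmor := hP.exists_mor_normalizer hS hF hQP
  set N : Subgroup S := Subgroup.normalizer (Q : Set S)
  obtain ⟨f, hf, hfP⟩ := hmor
  have hmark : ∀ R : Subgroup N,
      BurnsideRing.ghost (BurnsideRing.res f x - BurnsideRing.res N.subtype x) R =
        ((BurnsideRing.mark (R.map f) x - BurnsideRing.mark (R.map N.subtype) x : ℤ) : ℚ) :=
    fun R => by
      rw [BurnsideRing.ghost_apply, map_sub, BurnsideRing.mark_res, BurnsideRing.mark_res]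
  obtain ⟨n, hn⟩ := BurnsideRing.exists_moebiusTransform_ghost_eq (Q.subgroupOf N)
    (BurnsideRing.res f x - BurnsideRing.res N.subtype x)
  rw [moebiusTransform_eq_apply_of_forall_lt, hmark, hfP,
    Subgroup.map_subgroupOf_eq_of_le Subgroup.le_normalizer,
    mark_coset_subgroupOf_normalizer] at hn
  · exact Dvd.intro_left n (mod_cast hn.symm)
  · intro R hR
    have hcard : Nat.card P + 1 ≤ Nat.card (R.map N.subtype) := by
      rw [← hQP.card_eq, Subgroup.card_map_of_injective N.subtype_injective,
        ← Nat.card_congr (Subgroup.subgroupOfEquivOfLe Subgroup.le_normalizer).toEquiv]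
      exact Set.ncard_lt_ncard hR
    rw [hmark, hx _ _ hcard (F.conj_map hf R), sub_self, Int.cast_zero]

variable (S) in
/-- The subgroup of `A(S)` spanned by the `[S/R]` with `|R| < n`. -/
noncomputable def cosetSpan (n : ℕ) : AddSubgroup (BurnsideRing S) :=
  AddSubgroup.closure {x | ∃ R : Subgroup S, Nat.card R < n ∧ BurnsideRing.coset R = x}

theorem coset_mem_cosetSpan {n : ℕ} {R : Subgroup S} (h : Nat.card R < n) :
    BurnsideRing.coset R ∈ cosetSpan S n :=
  AddSubgroup.subset_closure ⟨R, h, rfl⟩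

theorem exists_mem_cosetSpan_mark_eq {n : ℕ} {f : Subgroup S → ℤ}
    (hf : ∀ R s, f (R.map (MulAut.conj s).toMonoidHom) = f R)
    (hdvd : ∀ R : Subgroup S, Nat.card R = n → BurnsideRing.mark R (BurnsideRing.coset R) ∣ f R) :
    ∃ y ∈ cosetSpan S (n + 1), ∀ Q : Subgroup S, n ≤ Nat.card Q →
      BurnsideRing.mark Q y = if Nat.card Q = n then f Q else 0 := by
  classical
  have : Fintype (Quotient (subgroupConjSetoid S)) := Fintype.ofFinite _
  have hcoeff : ∀ r : Quotient (subgroupConjSetoid S), ∃ c : ℤ,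
      (Nat.card r.out = n → c * BurnsideRing.mark r.out (BurnsideRing.coset r.out) = f r.out) ∧
      (Nat.card r.out ≠ n → c = 0) := fun r => by
    by_cases h : Nat.card r.out = n
    · obtain ⟨c, hc⟩ := hdvd r.out h
      exact ⟨c, fun _ => by rw [hc, mul_comm], fun h' => absurd h h'⟩
    · exact ⟨0, fun h' => absurd h' h, fun _ => rfl⟩
  choose c hc hc0 using hcoeff
  have hcard : ∀ r, c r ≠ 0 → Nat.card r.out = n := fun r hr => not_imp_comm.1 (hc0 r) hr
  refine ⟨∑ᶠ r, c r • BurnsideRing.coset r.out, ?_, fun Q hQ => ?_⟩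
  · rw [finsum_eq_sum_of_fintype]
    refine sum_mem fun r _ => ?_
    by_cases hr : c r = 0
    · rw [hr, zero_smul]
      exact zero_mem _
    · exact zsmul_mem (coset_mem_cosetSpan (hcard r hr ▸ n.lt_succ_self)) _
  · obtain ⟨s, hs⟩ := (subgroupConjSetoid S).symm
      (Quotient.mk_out (s := subgroupConjSetoid S) Q)
    have hcardQ : Nat.card (Quotient.mk (subgroupConjSetoid S) Q).out = Nat.card Q := by
      rw [← hs, card_map_conj]
    rw [BurnsideRing.mark_sum_coset_of_card_le _ _ fun r hr => (hcard r hr).trans_le hQ]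
    split_ifs with h
    · have := hc (Quotient.mk _ Q) (hcardQ.trans h)
      rwa [BurnsideRing.coset_out, BurnsideRing.mark_out, ← hs, hf] at this
    · rw [hc0 _ fun h' => h (hcardQ.symm.trans h'), zero_mul]

theorem StableFrom.exists_add_of_succ {p : ℕ} [Fact p.Prime] (hS : IsPGroup p S)
    (hF : F.IsSaturated p) {n : ℕ} {x : BurnsideRing S} (hx : F.StableFrom (n + 1) x) :
    ∃ y ∈ cosetSpan S (n + 1), F.StableFrom n (x + y) := by
  choose P hconj hfull using fun C : F.ConjClass => F.exists_fullyNormalized C.out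
  have hP : ∀ Q, F.Conj Q (P (Quotient.mk _ Q)) := fun Q =>
    (F.conjSetoid.symm (Quotient.mk_out (s := F.conjSetoid) Q)).trans (hconj _)
  have hclass : ∀ {Q Q'}, F.Conj Q Q' → P (Quotient.mk _ Q) = P (Quotient.mk _ Q') := fun h =>
    congrArg P (Quotient.sound h)
  obtain ⟨y, hy, hmark⟩ := exists_mem_cosetSpan_mark_eq (n := n)
    (f := fun Q => BurnsideRing.mark (P (Quotient.mk _ Q)) x - BurnsideRing.mark Q x)
    (fun R s => by rw [BurnsideRing.mark_map_conj, hclass (F.conj_map_conj R s)])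
    (fun R hR => mark_coset_dvd hS hF (hfull _) (hP R) (by rwa [← (hP R).card_eq, hR]))
  refine ⟨y, hy, fun Q Q' hQ h => ?_⟩
  rw [map_add, map_add, hmark Q hQ, hmark Q' (by rwa [← h.card_eq]), ← h.card_eq]
  split_ifs with hcard
  · rw [hclass h, add_sub_cancel, add_sub_cancel]
  · rw [hx Q Q' (lt_of_le_of_ne hQ (Ne.symm hcard)) h]

theorem StableFrom.exists_add_mem_burnsideRing {p : ℕ} [Fact p.Prime] (hS : IsPGroup p S)
    (hF : F.IsSaturated p) {n : ℕ} {x : BurnsideRing S} (hx : F.StableFrom n x) :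
    ∃ y ∈ cosetSpan S n, x + y ∈ F.burnsideRing := by
  induction n generalizing x with
  | zero => exact ⟨0, zero_mem _, by
      rw [add_zero]
      exact mem_burnsideRing_of_mark_eq fun Q Q' => hx Q Q' (Nat.zero_le _)⟩
  | succ n ih =>
    obtain ⟨y, hy, hxy⟩ := hx.exists_add_of_succ hS hF
    obtain ⟨z, hz, hxyz⟩ := ih hxy
    have hle : cosetSpan S n ≤ cosetSpan S (n + 1) :=
      AddSubgroup.closure_mono fun _ ⟨R, hR, hx⟩ => ⟨R, hR.trans n.lt_succ_self, hx⟩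
    exact ⟨y + z, add_mem hy (hle hz), by rwa [← add_assoc]⟩

end FusionSystem

/-! ### Averages over `F`-conjugacy classes -/

namespace FusionSystem

variable {S : Type u} [Group S] (F : FusionSystem S)

open Classical in
/-- The coefficient `|N_S(P)| / |N_S(R)|` of `[S/R]` in `F.conjSum P`. The division is exact if `P`
is fully normalized. -/
noncomputable def conjSumCoeff (P : Subgroup S) (r : Quotient (subgroupConjSetoid S)) : ℤ :=
  if F.Conj P r.out then
    Nat.card (Subgroup.normalizer (P : Set S)) / Nat.card (Subgroup.normalizer (r.out : Set S))
  else 0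

variable {F} in
theorem card_out_of_conjSumCoeff_ne_zero {P : Subgroup S}
    {r : Quotient (subgroupConjSetoid S)} (h : F.conjSumCoeff P r ≠ 0) :
    Nat.card r.out = Nat.card P :=
  (not_imp_comm.1 (fun h' => if_neg h') h : F.Conj P r.out).card_eq.symm

variable [Finite S]

/-- The averaging operator on functions on the set of subgroups of `S`: its value at `Q` is the
average over the `F`-conjugacy class of `Q`. -/
noncomputable def average : (Subgroup S → ℚ) →ₗ[ℚ] (Subgroup S → ℚ) where
  toFun f Q := 1 / (Nat.card {Q' : Subgroup S // F.Conj Q Q'} : ℚ) *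
    ∑ᶠ Q' : {Q' : Subgroup S // F.Conj Q Q'}, f Q'.1
  map_add' f g := by
    ext Q
    rw [Pi.add_apply, ← mul_add, ← finsum_add_distrib (Set.toFinite _) (Set.toFinite _)]
    rfl
  map_smul' c f := by
    ext Q
    rw [RingHom.id_apply, Pi.smul_apply, smul_eq_mul, mul_left_comm,
      mul_finsum (f := fun _ => _) c]
    rfl

theorem average_apply (f : Subgroup S → ℚ) (Q : Subgroup S) :
    F.average f Q = 1 / (Nat.card {Q' : Subgroup S // F.Conj Q Q'} : ℚ) *
      ∑ᶠ Q' : {Q' : Subgroup S // F.Conj Q Q'}, f Q'.1 := rfl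

theorem card_conj_ne_zero (Q : Subgroup S) :
    Nat.card {Q' : Subgroup S // F.Conj Q Q'} ≠ 0 := by
  have : Nonempty {Q' : Subgroup S // F.Conj Q Q'} := ⟨⟨Q, Conj.refl F Q⟩⟩
  exact Nat.card_pos.ne'

theorem average_apply_congr (f : Subgroup S → ℚ) {Q Q' : Subgroup S} (h : F.Conj Q Q') :
    F.average f Q = F.average f Q' := by
  rw [average_apply, average_apply, conj_left_eq h]

theorem average_eq_self {f : Subgroup S → ℚ} (h : ∀ Q Q', F.Conj Q Q' → f Q' = f Q) :
    F.average f = f := by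
  ext Q
  have := Fintype.ofFinite {Q' : Subgroup S // F.Conj Q Q'}
  rw [average_apply, finsum_congr (g := fun _ => f Q) fun Q' : {Q' : Subgroup S // F.Conj Q Q'} =>
    h Q Q'.1 Q'.2, finsum_eq_sum_of_fintype, Finset.sum_const, Finset.card_univ,
    ← Nat.card_eq_fintype_card, nsmul_eq_mul, ← mul_assoc,
    one_div_mul_cancel (Nat.cast_ne_zero.2 (F.card_conj_ne_zero Q)), one_mul]

theorem card_sigma_conj_le (P Q : Subgroup S) :
    Nat.card (Σ Q' : {Q' : Subgroup S // F.Conj Q Q'},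
        {s : S // Q'.1.map (MulAut.conj s⁻¹).toMonoidHom ≤ P}) =
      Nat.card S * Nat.card {Q' : {Q' : Subgroup S // F.Conj Q Q'} // Q'.1 ≤ P} := by
  have hfiber : ∀ s : S, Nat.card {Q' : {Q' : Subgroup S // F.Conj Q Q'} //
      Q'.1.map (MulAut.conj s⁻¹).toMonoidHom ≤ P} =
        Nat.card {Q' : {Q' : Subgroup S // F.Conj Q Q'} // Q'.1 ≤ P} := fun s =>
    Nat.card_congr (Equiv.subtypeEquiv
      ((MulAut.conj s⁻¹).mapSubgroup.toEquiv.subtypeEquiv fun _ => (conj_map_conj_iff s⁻¹).symm)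
      fun _ => Iff.rfl)
  have hswap := Nat.card_congr (Equiv.subtypeEquiv
    (Equiv.prodComm {Q' : Subgroup S // F.Conj Q Q'} S)
    (p := fun z => z.1.1.map (MulAut.conj z.2⁻¹).toMonoidHom ≤ P)
    (q := fun z => z.2.1.map (MulAut.conj z.1⁻¹).toMonoidHom ≤ P) fun _ => Iff.rfl)
  have := Fintype.ofFinite S
  rw [← Nat.card_congr (Equiv.subtypeProdEquivSigmaSubtype _), hswap,
    Nat.card_congr (Equiv.subtypeProdEquivSigmaSubtype fun (s : S)
      (Q' : {Q' : Subgroup S // F.Conj Q Q'}) => Q'.1.map (MulAut.conj s⁻¹).toMonoidHom ≤ P),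
    Nat.card_sigma, Finset.sum_congr rfl fun s _ => hfiber s, Finset.sum_const, smul_eq_mul,
    Finset.card_univ, ← Nat.card_eq_fintype_card (α := S)]

theorem average_ghost_coset_apply (P Q : Subgroup S) :
    F.average (BurnsideRing.ghost (BurnsideRing.coset P)) Q =
      (Nat.card (F.Hom Q P) * Nat.card S : ℚ) / (Nat.card P * Nat.card (F.Hom Q ⊤)) := by
  have := Fintype.ofFinite {Q' : Subgroup S // F.Conj Q Q'}
  have hsum : (∑ Q' : {Q' : Subgroup S // F.Conj Q Q'},
      FinGSet.fixedCard Q'.1 (FinGSet.coset P)) * Nat.card P =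
      Nat.card S * Nat.card {Q' : {Q' : Subgroup S // F.Conj Q Q'} // Q'.1 ≤ P} := by
    simp only [Finset.sum_mul, FinGSet.fixedCard_coset_mul_card]
    rw [← Nat.card_sigma, card_sigma_conj_le]
  have haut : (Nat.card (F.aut Q) : ℚ) ≠ 0 := Nat.cast_ne_zero.2 Nat.card_pos.ne'
  have hP : (Nat.card P : ℚ) ≠ 0 := Nat.cast_ne_zero.2 Nat.card_pos.ne'
  have h0 : (Nat.card {Q' : Subgroup S // F.Conj Q Q'} : ℚ) ≠ 0 :=
    Nat.cast_ne_zero.2 (F.card_conj_ne_zero Q)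
  rw [← card_mor, card_mor_eq, card_hom, average_apply, finsum_eq_sum_of_fintype]
  simp only [BurnsideRing.ghost_apply, BurnsideRing.mark_coset, Int.cast_natCast]
  rw [← Nat.cast_sum]
  have hsum' := congrArg (Nat.cast : ℕ → ℚ) hsum
  push_cast at hsum' ⊢
  field_simp
  linear_combination hsum'

theorem average_ghost_coset_congr {P P' : Subgroup S} (h : F.Conj P P') :
    F.average (BurnsideRing.ghost (BurnsideRing.coset P)) =
      F.average (BurnsideRing.ghost (BurnsideRing.coset P')) := by
  ext Q
  rw [average_ghost_coset_apply, average_ghost_coset_apply, F.card_hom_congr Q h, h.card_eq]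

/-! ### Averages of marks -/

/-- The combination `∑ (|N_S(P)| / |N_S(R)|) [S/R]`, where `R` runs over the `S`-conjugacy classes
in the `F`-conjugacy class of `P`. -/
noncomputable def conjSum (P : Subgroup S) : BurnsideRing S :=
  ∑ᶠ r, F.conjSumCoeff P r • BurnsideRing.coset r.out

variable {F}

theorem average_ghost_conjSum [Fintype (Quotient (subgroupConjSetoid S))] (P : Subgroup S) :
    F.average (BurnsideRing.ghost (F.conjSum P)) =
      ((∑ r, F.conjSumCoeff P r : ℤ) : ℚ) •
        F.average (BurnsideRing.ghost (BurnsideRing.coset P)) := by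
  rw [conjSum, BurnsideRing.ghost_sum_coset, finsum_eq_sum_of_fintype, map_sum, Int.cast_sum,
    Finset.sum_smul]
  refine Finset.sum_congr rfl fun r _ => ?_
  rw [map_smul]
  by_cases h : F.Conj P r.out
  · rw [F.average_ghost_coset_congr h]
  · rw [conjSumCoeff, if_neg h, Int.cast_zero, zero_smul, zero_smul]

variable {p : ℕ} [hp : Fact p.Prime]

theorem FullyNormalized.conjSumCoeff_mul_card (hS : IsPGroup p S) {P : Subgroup S}
    (hP : F.FullyNormalized P) {r : Quotient (subgroupConjSetoid S)} (h : F.Conj P r.out) :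
    F.conjSumCoeff P r * Nat.card (Subgroup.normalizer (r.out : Set S)) =
      Nat.card (Subgroup.normalizer (P : Set S)) := by
  rw [conjSumCoeff, if_pos h]
  exact Int.ediv_mul_cancel (Int.natCast_dvd_natCast.2 (card_dvd_card_of_card_le hS (hP _ h)))

theorem FullyNormalized.sum_conjSumCoeff_mul_card (hS : IsPGroup p S)
    [Fintype (Quotient (subgroupConjSetoid S))] {P : Subgroup S} (hP : F.FullyNormalized P) :
    (∑ r, F.conjSumCoeff P r) * Nat.card S =
      Nat.card {Q : Subgroup S // F.Conj P Q} * Nat.card (Subgroup.normalizer (P : Set S)) := by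
  classical
  have := Fintype.ofFinite (Subgroup S)
  have hclass : ∑ R : Subgroup S, (if F.Conj P R then 1 else 0 : ℤ) =
      ∑ r : Quotient (subgroupConjSetoid S),
        (Subgroup.normalizer (r.out : Set S)).index • if F.Conj P r.out then 1 else 0 :=
    sum_subgroup_eq_sum_class fun R s => if_congr (conj_map_conj_iff s) rfl rfl
  rw [Finset.sum_boole, ← Fintype.card_subtype, ← Nat.card_eq_fintype_card] at hclass
  rw [hclass, Finset.sum_mul, Finset.sum_mul]
  refine Finset.sum_congr rfl fun r _ => ?_
  by_cases h : F.Conj P r.out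
  · rw [if_pos h, ← hP.conjSumCoeff_mul_card hS h,
      ← Subgroup.index_mul_card (Subgroup.normalizer (r.out : Set S))]
    push_cast
    ring
  · rw [if_neg h, conjSumCoeff, if_neg h, zero_mul, smul_zero, zero_mul]

theorem FullyNormalized.sum_conjSumCoeff_ne_zero (hS : IsPGroup p S)
    [Fintype (Quotient (subgroupConjSetoid S))] {P : Subgroup S} (hP : F.FullyNormalized P) :
    ∑ r, F.conjSumCoeff P r ≠ 0 := by
  refine left_ne_zero_of_mul (b := (Nat.card S : ℤ)) ?_
  rw [hP.sum_conjSumCoeff_mul_card hS]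
  exact mul_ne_zero (Nat.cast_ne_zero.2 (F.card_conj_ne_zero P))
    (Nat.cast_ne_zero.2 Nat.card_pos.ne')

theorem FullyNormalized.stableFrom_conjSum (hS : IsPGroup p S) {P : Subgroup S}
    (hP : F.FullyNormalized P) : F.StableFrom (Nat.card P) (F.conjSum P) := by
  classical
  have hmark : ∀ Q : Subgroup S, Nat.card P ≤ Nat.card Q →
      BurnsideRing.mark Q (F.conjSum P) * Nat.card P =
        if F.Conj P Q then (Nat.card (Subgroup.normalizer (P : Set S)) : ℤ) else 0 := by
    intro Q hQ
    have hmark_eq := BurnsideRing.mark_sum_coset_of_card_le (F.conjSumCoeff P) Q fun r hr =>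
      (card_out_of_conjSumCoeff_ne_zero hr).trans_le hQ
    rw [conjSum, hmark_eq]
    split_ifs with h
    · rw [← hP.conjSumCoeff_mul_card hS (conj_out_iff.2 h), mul_assoc, h.card_eq,
        ← BurnsideRing.mark_coset_self_mul_card, BurnsideRing.coset_out, BurnsideRing.mark_out,
        ← h.card_eq, (conj_out_iff.2 h).card_eq]
    · rw [conjSumCoeff, if_neg (mt conj_out_iff.1 h), zero_mul, zero_mul]
  refine fun Q Q' hQ h => mul_right_cancel₀ (Nat.cast_ne_zero.2 (Nat.card_pos (α := P)).ne') ?_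
  rw [hmark Q hQ, hmark Q' (by rwa [← h.card_eq])]
  exact if_congr ⟨fun h' => h'.trans h.symm, fun h' => h'.trans h⟩ rfl rfl

theorem FullyNormalized.inv_sum_conjSumCoeff_mem (hS : IsPGroup p S) (hF : F.IsSaturated p)
    [Fintype (Quotient (subgroupConjSetoid S))] {P : Subgroup S} (hP : F.FullyNormalized P) :
    (((∑ r, F.conjSumCoeff P r : ℤ) : ℚ))⁻¹ ∈ ZLocal p := by
  obtain ⟨k, hk⟩ := IsPGroup.iff_card.1 hS
  have hmem := ZLocal.div_mem_of_not_dvd (hk ▸ not_dvd_card_conj hS hF P)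
  have hsum : ((∑ r, F.conjSumCoeff P r : ℤ) : ℚ) * Nat.card S =
      (Nat.card {Q : Subgroup S // F.Conj P Q} * Nat.card (Subgroup.normalizer (P : Set S)) : ℕ) :=
    mod_cast hP.sum_conjSumCoeff_mul_card hS
  rwa [← hk, ← hsum, div_mul_cancel_right₀ (Nat.cast_ne_zero.2 Nat.card_pos.ne')] at hmem

/-- For `P` fully normalized, `F.conjSum P` can be made stable by adding cosets `S/R` with
`|R| < |P|`. Averaging fixes the result and turns `F.conjSum P` into a `p`-local unit times the
average of `[S/P]`, so induction on `|P|` applies. -/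
theorem average_ghost_coset_mem_range (hS : IsPGroup p S) (hF : F.IsSaturated p) (P : Subgroup S) :
    F.average (BurnsideRing.ghost (BurnsideRing.coset P)) ∈
      LinearMap.range (LocalBurnsideRing.ghost p (G := S)) := by
  induction h : Nat.card P using Nat.strong_induction_on generalizing P with
  | _ n ih =>
    obtain ⟨K, hPK, hK⟩ := F.exists_fullyNormalized P
    have := Fintype.ofFinite (Quotient (subgroupConjSetoid S))
    obtain ⟨y, hy, hstable⟩ := (hK.stableFrom_conjSum hS).exists_add_mem_burnsideRing hS hF
    have hspan : cosetSpan S (Nat.card K) ≤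
        (LinearMap.range (LocalBurnsideRing.ghost p (G := S))).toAddSubgroup.comap
          (F.average.toAddMonoidHom.comp BurnsideRing.ghost) := by
      refine (AddSubgroup.closure_le _).2 ?_
      rintro _ ⟨R, hR, rfl⟩
      exact ih _ (by rwa [← h, hPK.card_eq]) R rfl
    have hfix : F.average (BurnsideRing.ghost (F.conjSum K + y)) =
        BurnsideRing.ghost (F.conjSum K + y) := F.average_eq_self fun Q Q' hQ =>
      congrArg Int.cast (mark_eq_of_mem_burnsideRing hstable hQ)
    have hmem : ((∑ r, F.conjSumCoeff K r : ℤ) : ℚ) •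
        F.average (BurnsideRing.ghost (BurnsideRing.coset K)) ∈
          LinearMap.range (LocalBurnsideRing.ghost p (G := S)) := by
      rw [← average_ghost_conjSum, ← add_sub_cancel_right (F.conjSum K) y, map_sub, map_sub, hfix]
      exact sub_mem (LocalBurnsideRing.ghost_mem_range p _) (hspan hy)
    have hne : ((∑ r, F.conjSumCoeff K r : ℤ) : ℚ) ≠ 0 :=
      Int.cast_ne_zero.2 (hK.sum_conjSumCoeff_ne_zero hS)
    rw [F.average_ghost_coset_congr hPK, ← inv_smul_smul₀ hne (F.average _)]
    exact Submodule.smul_mem _ (⟨_, hK.inv_sum_conjSumCoeff_mem hS hF⟩ : ZLocal p) hmem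

theorem average_ghost_mem_range (hS : IsPGroup p S) (hF : F.IsSaturated p)
    (X : LocalBurnsideRing p S) :
    F.average (LocalBurnsideRing.ghost p X) ∈
      LinearMap.range (LocalBurnsideRing.ghost p (G := S)) := by
  obtain ⟨z, -, x, rfl⟩ := LocalBurnsideRing.exists_eq_tmul p X
  obtain ⟨n, rfl⟩ := BurnsideRing.exists_eq_sum_coset x
  have := Fintype.ofFinite (Quotient (subgroupConjSetoid S))
  rw [LocalBurnsideRing.ghost_tmul, map_smul, BurnsideRing.ghost_sum_coset,
    finsum_eq_sum_of_fintype, map_sum]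
  refine Submodule.smul_mem _ z (sum_mem fun r _ => ?_)
  rw [map_smul, Int.cast_smul_eq_zsmul]
  exact zsmul_mem (average_ghost_coset_mem_range hS hF r.out) _

end FusionSystem

/-! ### The stabilization map -/

theorem linearIndependent_of_triangular {ι R M α : Type*} [CommRing R] [NoZeroDivisors R]
    [AddCommGroup M] [Module R M] [LinearOrder α] {v : ι → M} {φ : ι → M →ₗ[R] R} {d : ι → α}
    (hdiag : ∀ i, φ i (v i) ≠ 0) (htri : ∀ i j, φ i (v j) ≠ 0 → i = j ∨ d i < d j) :
    LinearIndependent R v := by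
  classical
  refine linearIndependent_iff'.2 fun s g hg => ?_
  by_contra! hne
  obtain ⟨i₀, hi₀, hgi₀⟩ := hne
  obtain ⟨i, hi, hmax⟩ := (s.filter fun i => g i ≠ 0).exists_max_image d
    ⟨i₀, Finset.mem_filter.2 ⟨hi₀, hgi₀⟩⟩
  obtain ⟨his, hgi⟩ := Finset.mem_filter.1 hi
  refine mul_ne_zero hgi (hdiag i) ?_
  rw [← map_zero (φ i), ← hg, map_sum, Finset.sum_eq_single_of_mem i his, map_smul, smul_eq_mul]
  intro j hj hji
  rw [map_smul, smul_eq_mul]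
  by_contra! h0
  obtain hij | hlt := htri i j (right_ne_zero_of_mul h0)
  · exact hji hij.symm
  · exact (hmax j (Finset.mem_filter.2 ⟨hj, left_ne_zero_of_mul h0⟩)).not_gt hlt

namespace FusionSystem

variable {S : Type u} [Group S] {F : FusionSystem S} {p : ℕ} [hp : Fact p.Prime]

theorem subConj_of_card_hom_ne_zero {Q R P : Subgroup S} (hRQ : R ≤ Q)
    (h : Nat.card (F.Hom Q P) ≠ 0) : F.SubConj R P := by
  obtain ⟨⟨φ, hφ⟩⟩ := (Nat.card_ne_zero.1 h).1
  refine ⟨_, ?_, F.conj_range (F.mor_restrict (F.subtype_comp_mem_mor hφ) hRQ)⟩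
  rintro _ ⟨x, rfl⟩
  exact (φ _).2

theorem ghost_eq_of_mem_localBurnsideRing {X : LocalBurnsideRing p S}
    (hX : X ∈ F.localBurnsideRing p) {Q Q' : Subgroup S} (h : F.Conj Q Q') :
    LocalBurnsideRing.ghost p X Q' = LocalBurnsideRing.ghost p X Q := by
  obtain ⟨Y, rfl⟩ := hX
  induction Y using TensorProduct.induction_on with
  | zero => simp only [map_zero, Pi.zero_apply]
  | tmul z y =>
    change LocalBurnsideRing.ghost p (z ⊗ₜ (y : BurnsideRing S)) Q' =
      LocalBurnsideRing.ghost p (z ⊗ₜ (y : BurnsideRing S)) Q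
    rw [LocalBurnsideRing.ghost_tmul, Pi.smul_apply, Pi.smul_apply, BurnsideRing.ghost_apply,
      BurnsideRing.ghost_apply, mark_eq_of_mem_burnsideRing y.2 h]
  | add Y Z hY hZ => simp only [map_add, Pi.add_apply, hY, hZ]

variable [Finite S]

theorem card_hom_ne_zero {P Q : Subgroup S} (h : P ≤ Q) : Nat.card (F.Hom P Q) ≠ 0 := by
  have : Nonempty (F.Hom P Q) := ⟨⟨_, F.inclusion_mem h⟩⟩
  have : Finite (P →* Q) := DFunLike.finite _
  exact Nat.card_pos.ne'

theorem mem_localBurnsideRing_of_ghost_eq {X : LocalBurnsideRing p S}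
    (h : ∀ Q Q', F.Conj Q Q' → LocalBurnsideRing.ghost p X Q' = LocalBurnsideRing.ghost p X Q) :
    X ∈ F.localBurnsideRing p := by
  obtain ⟨z, hz, x, rfl⟩ := LocalBurnsideRing.exists_eq_tmul p X
  suffices hx : x ∈ F.burnsideRing from ⟨z ⊗ₜ ⟨x, hx⟩, rfl⟩
  refine mem_burnsideRing_of_mark_eq fun Q Q' hQ => ?_
  have hz0 : (z : ℚ) ≠ 0 := fun h0 => hz (Subtype.ext h0)
  have hghost := h Q Q' hQ
  rw [LocalBurnsideRing.ghost_tmul, Pi.smul_apply, Pi.smul_apply, BurnsideRing.ghost_apply,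
    BurnsideRing.ghost_apply] at hghost
  exact_mod_cast smul_right_injective ℚ hz0 hghost

theorem exists_isStabilization (hS : IsPGroup p S) (hF : F.IsSaturated p) :
    ∃ π : LocalBurnsideRing p S →ₗ[ZLocal p] F.localBurnsideRing p, F.IsStabilization p π := by
  have hinj := LocalBurnsideRing.ghost_injective p (G := S)
  let ψ : LocalBurnsideRing p S →ₗ[ZLocal p] LocalBurnsideRing p S :=
    (LinearEquiv.ofInjective _ hinj).symm ∘ₗ
      ((F.average.restrictScalars (ZLocal p)) ∘ₗ LocalBurnsideRing.ghost p).codRestrict _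
        (average_ghost_mem_range hS hF)
  have hψ : ∀ X, LocalBurnsideRing.ghost p (ψ X) = F.average (LocalBurnsideRing.ghost p X) :=
    fun X => congrArg Subtype.val ((LinearEquiv.ofInjective _ hinj).apply_symm_apply _)
  have hmem : ∀ X, ψ X ∈ F.localBurnsideRing p := fun X =>
    mem_localBurnsideRing_of_ghost_eq fun Q Q' h => by
      rw [hψ, F.average_apply_congr _ h]
  refine ⟨ψ.codRestrict (Subalgebra.toSubmodule (F.localBurnsideRing p)) hmem, fun X Y => ?_⟩
  change ψ X = Y ↔ ∀ Q, LocalBurnsideRing.ghost p Y Q = F.average (LocalBurnsideRing.ghost p X) Q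
  rw [← funext_iff, ← hψ, hinj.eq_iff]
  exact eq_comm

variable {π : LocalBurnsideRing p S →ₗ[ZLocal p] F.localBurnsideRing p}

theorem IsStabilization.ghost_apply (h : F.IsStabilization p π) (X : LocalBurnsideRing p S) :
    LocalBurnsideRing.ghost p (π X : LocalBurnsideRing p S) =
      F.average (LocalBurnsideRing.ghost p X) :=
  funext ((h X _).1 rfl)

theorem IsStabilization.apply_coe (h : F.IsStabilization p π) (X : F.localBurnsideRing p) :
    π X = X :=
  Subtype.ext <| LocalBurnsideRing.ghost_injective p <| by
    rw [h.ghost_apply, F.average_eq_self fun _ _ => ghost_eq_of_mem_localBurnsideRing X.2]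

theorem IsStabilization.mark_coset (h : F.IsStabilization p π) (P Q : Subgroup S) :
    (LocalBurnsideRing.mark p Q (π (LocalBurnsideRing.coset p P)) : ℚ) =
      (Nat.card (F.Hom Q P) * Nat.card S : ℚ) / (Nat.card P * Nat.card (F.Hom Q ⊤)) := by
  rw [← LocalBurnsideRing.ghost_apply, h.ghost_apply, LocalBurnsideRing.ghost_coset,
    average_ghost_coset_apply]

theorem IsStabilization.coset_congr (h : F.IsStabilization p π) {P P' : Subgroup S}
    (hP : F.Conj P P') :
    π (LocalBurnsideRing.coset p P) = π (LocalBurnsideRing.coset p P') :=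
  Subtype.ext <| LocalBurnsideRing.ghost_injective p <| by
    rw [h.ghost_apply, h.ghost_apply, LocalBurnsideRing.ghost_coset,
      LocalBurnsideRing.ghost_coset, F.average_ghost_coset_congr hP]

theorem IsStabilization.mark_coset_ne_zero_iff (h : F.IsStabilization p π) {P Q : Subgroup S} :
    LocalBurnsideRing.mark p Q (π (LocalBurnsideRing.coset p P)) ≠ 0 ↔
      Nat.card (F.Hom Q P) ≠ 0 := by
  have hS : Nat.card S ≠ 0 := Nat.card_pos.ne'
  have hden : Nat.card P * Nat.card (F.Hom Q ⊤) ≠ 0 :=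
    mul_ne_zero Nat.card_pos.ne' (card_hom_ne_zero le_top)
  rw [← Subtype.coe_ne_coe, h.mark_coset, ZeroMemClass.coe_zero]
  rw [← Nat.cast_mul, ← Nat.cast_mul, div_ne_zero_iff, Nat.cast_ne_zero, Nat.cast_ne_zero,
    and_iff_left hden, mul_ne_zero_iff, and_iff_left hS]

theorem IsStabilization.linearIndependent (h : F.IsStabilization p π) :
    LinearIndependent (ZLocal p)
      fun c : F.ConjClass => π (LocalBurnsideRing.coset p c.out) := by
  -- The marks of the `β_P` form a matrix that is triangular with respect to the order of `P`.
  let β (c : F.ConjClass) := π (LocalBurnsideRing.coset p c.out)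
  let φ (c : F.ConjClass) : F.localBurnsideRing p →ₗ[ZLocal p] ZLocal p :=
    (LocalBurnsideRing.mark p c.out).toLinearMap ∘ₗ (F.localBurnsideRing p).val.toLinearMap
  have hφ (c d : F.ConjClass) : φ c (β d) ≠ 0 ↔ Nat.card (F.Hom c.out d.out) ≠ 0 :=
    h.mark_coset_ne_zero_iff
  have hdiag (c : F.ConjClass) : φ c (β c) ≠ 0 := (hφ c c).2 (card_hom_ne_zero le_rfl)
  refine linearIndependent_of_triangular (v := β) (d := fun c => Nat.card c.out) hdiag
    fun c d hcd => ?_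
  obtain ⟨Q, hQ, hconj⟩ := subConj_of_card_hom_ne_zero le_rfl ((hφ c d).1 hcd)
  refine or_iff_not_imp_right.2 fun hlt => Quotient.out_equiv_out.1 ?_
  rwa [Subgroup.eq_of_le_of_card_ge hQ (hconj.card_eq ▸ not_lt.1 hlt)] at hconj

theorem IsStabilization.span_eq_top (h : F.IsStabilization p π) :
    ⊤ ≤ Submodule.span (ZLocal p)
      (Set.range fun c : F.ConjClass => π (LocalBurnsideRing.coset p c.out)) := by
  have := Fintype.ofFinite (Quotient (subgroupConjSetoid S))
  rintro X -
  obtain ⟨c, hc⟩ := LocalBurnsideRing.exists_eq_sum_coset p (X : LocalBurnsideRing p S)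
  rw [← h.apply_coe X, hc, finsum_eq_sum_of_fintype, map_sum]
  refine Submodule.sum_mem _ fun r _ => ?_
  rw [map_smul]
  refine Submodule.smul_mem _ _ (Submodule.subset_span ⟨Quotient.mk _ r.out, ?_⟩)
  exact h.coset_congr (Quotient.mk_out (s := F.conjSetoid) r.out)

theorem IsStabilization.coeff_eq (h : F.IsStabilization p π) {P : Subgroup S}
    {c : Quotient (subgroupConjSetoid S) → ZLocal p}
    (hc : (π (LocalBurnsideRing.coset p P) : LocalBurnsideRing p S) =
      ∑ᶠ r, c r • LocalBurnsideRing.coset p r.out) (R : Subgroup S) :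
    (c (Quotient.mk _ R) : ℚ) =
      (Nat.card R * Nat.card S : ℚ) /
          (Nat.card (Subgroup.normalizer (R : Set S)) * Nat.card P) *
        ∑ᶠ Q : {Q : Subgroup S // R ≤ Q},
          (Nat.card (F.Hom Q.1 P) : ℚ) / Nat.card (F.Hom Q.1 ⊤) * (subgroupMoebius R Q.1 : ℚ) := by
  have hR : (Nat.card R : ℚ) ≠ 0 := Nat.cast_ne_zero.2 Nat.card_pos.ne'
  have hmark : 1 / (BurnsideRing.mark R (BurnsideRing.coset R) : ℚ) =
      Nat.card R / Nat.card (Subgroup.normalizer (R : Set S)) := by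
    rw [← Int.cast_natCast (Nat.card (Subgroup.normalizer _)),
      ← BurnsideRing.mark_coset_self_mul_card, Int.cast_mul, Int.cast_natCast,
      div_mul_cancel_right₀ hR, one_div]
  rw [LocalBurnsideRing.coeff_eq_finsum_mark p hc, hmark, mul_finsum, mul_finsum]
  refine finsum_congr fun Q => ?_
  rw [h.mark_coset]
  ring

theorem IsStabilization.coeff_eq_zero (h : F.IsStabilization p π) {P : Subgroup S}
    {c : Quotient (subgroupConjSetoid S) → ZLocal p}
    (hc : (π (LocalBurnsideRing.coset p P) : LocalBurnsideRing p S) =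
      ∑ᶠ r, c r • LocalBurnsideRing.coset p r.out) {R : Subgroup S} (hR : ¬ F.SubConj R P) :
    c (Quotient.mk _ R) = 0 := by
  refine Subtype.ext ?_
  rw [h.coeff_eq hc, finsum_eq_zero_of_forall_eq_zero, mul_zero, ZeroMemClass.coe_zero]
  intro Q
  have hQ : Nat.card (F.Hom Q.1 P) = 0 :=
    not_not.1 fun hne => hR (subConj_of_card_hom_ne_zero Q.2 hne)
  rw [hQ, Nat.cast_zero, zero_div, zero_mul]

end FusionSystem

theorem mainTheorem11 (p : ℕ) [Fact p.Prime] (S : Type u) [Group S] [Finite S]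
    (hS : IsPGroup p S) (F : FusionSystem S) (hF : F.IsSaturated p) :
    ∃ π : LocalBurnsideRing p S →ₗ[ZLocal p] F.localBurnsideRing p,
      F.IsStabilization p π ∧
      -- the elements `β_P = π [S/P]`, one for each `F`-conjugacy class, form a basis
      (∃ b : Module.Basis F.ConjClass (ZLocal p) (F.localBurnsideRing p),
        ∀ P : Subgroup S, b (Quotient.mk _ P) = π (LocalBurnsideRing.coset p P)) ∧
      -- their marks
      (∀ P Q : Subgroup S,
        (LocalBurnsideRing.mark p Q (π (LocalBurnsideRing.coset p P)) : ℚ) =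
          (Nat.card (F.Hom Q P) * Nat.card S : ℚ) / (Nat.card P * Nat.card (F.Hom Q ⊤))) ∧
      -- their expansion in transitive `S`-sets
      (∀ P : Subgroup S, ∃ c : Quotient (subgroupConjSetoid S) → ZLocal p,
        (π (LocalBurnsideRing.coset p P) : LocalBurnsideRing p S) =
          ∑ᶠ r : Quotient (subgroupConjSetoid S), c r • LocalBurnsideRing.coset p r.out ∧
        (∀ R : Subgroup S, (c (Quotient.mk _ R) : ℚ) =
          1 / (BurnsideRing.mark R (BurnsideRing.coset R) : ℚ) *
            ∑ᶠ Q : {Q : Subgroup S // R ≤ Q},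
              (LocalBurnsideRing.mark p Q.1 (π (LocalBurnsideRing.coset p P)) : ℚ) *
                (subgroupMoebius R Q.1 : ℚ)) ∧
        (∀ R : Subgroup S, (c (Quotient.mk _ R) : ℚ) =
          (Nat.card R * Nat.card S : ℚ) /
              (Nat.card (Subgroup.normalizer (R : Set S)) * Nat.card P) *
            ∑ᶠ Q : {Q : Subgroup S // R ≤ Q},
              (Nat.card (F.Hom Q.1 P) : ℚ) / Nat.card (F.Hom Q.1 ⊤) *
                (subgroupMoebius R Q.1 : ℚ)) ∧
        (∀ R : Subgroup S, ¬ F.SubConj R P → c (Quotient.mk _ R) = 0)) := by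
  obtain ⟨π, hπ⟩ := FusionSystem.exists_isStabilization hS hF
  refine ⟨π, hπ, ⟨Module.Basis.mk hπ.linearIndependent hπ.span_eq_top, fun P => ?_⟩,
    hπ.mark_coset, fun P => ?_⟩
  · rw [Module.Basis.mk_apply]
    exact hπ.coset_congr (Quotient.mk_out (s := F.conjSetoid) P)
  · obtain ⟨c, hc⟩ := LocalBurnsideRing.exists_eq_sum_coset p
      (π (LocalBurnsideRing.coset p P) : LocalBurnsideRing p S)
    exact ⟨c, hc, LocalBurnsideRing.coeff_eq_finsum_mark p hc, hπ.coeff_eq hc,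
      fun R hR => hπ.coeff_eq_zero hc hR⟩
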